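/- Let $(M,g)$ be a finite-dimensional smooth Lorentzian manifold of signature $(+,\dots,+,-)$ with Levi-Civita derivative $\nabla$, and let $\Sigma$ be a $2$-dimensional timelike immersed submanifold of $M$, given by a smooth immersion $i:\Sigma\to M$ of a smooth $2$-dimensional manifold; timelike means that $g$ induces a scalar product of signature $(+,-)$ on every tangent space $T_p\Sigma$ (identified with $di(T_p\Sigma)\subset T_{i(p)}M$). Then the following two properties are equivalent. (a) $\Sigma$ is a photon $2$-surface: $\Sigma$ is nowhere spacelike, and for every $p\in\Sigma$ and every lightlike vector $w\in T_p\Sigma$ (that is, $w\neq 0$ and $g(w,w)=0$) there is an $\varepsilon>0$ such that the geodesic $\mu:\,]-\varepsilon,\varepsilon[\,\to M$ of $g$ with $\dot\mu(0)=w$ is contained in $\Sigma$, i.e. $\mu=i\circ\sigma$ for a smooth curve $\sigma:\,]-\varepsilon,\varepsilon[\,\to\Sigma$ with $\sigma(0)=p$ and $\dot\sigma(0)=w$. (b) $\Sigma$ is totally umbilic: there is a smooth vector field $Z$ along $\Sigma$, normal to $\Sigma$, such that $$\Pi(u,w)=g(u,w)\,Z$$ for all smooth vector fields $u,w$ on $\Sigma$,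 where $\Pi(u,w)=P^{\perp}(\nabla_u w)$ is the second fundamental form and $P^{\perp}_p:T_{i(p)}M\to (T_p\Sigma)^{\perp}$ is the $g$-orthogonal projection. -/

import Mathlib

open scoped Manifold ContDiff Topology
open Bundle

noncomputable section

namespace PhotonSurface

/-! ### Linear algebra of Lorentzian scalar products -/

section LinearAlgebra

variable {V : Type*} [AddCommGroup V] [Module ℝ V]

/-- A Lorentzian scalar product, i.e. a symmetric bilinear form of signature `(+, …, +, -)`: it is
negative on some vector and positive definite on the orthogonal complement of that vector. -/
structure IsLorentzForm (b : LinearMap.BilinForm ℝ V) : Prop where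
  symm : ∀ v w, b v w = b w v
  signature : ∃ v, b v v < 0 ∧ ∀ w, b v w = 0 → w ≠ 0 → 0 < b w w

open Classical in
/-- The `b`-orthogonal projection of `V` onto the orthogonal complement `W^⊥` of a subspace `W` for
which `V = W ⊕ W^⊥` (for other, degenerate, subspaces the value is `0` by convention). -/
def perpProj (b : LinearMap.BilinForm ℝ V) (W : Submodule ℝ V) : V →ₗ[ℝ] V :=
  if h : IsCompl (b.orthogonal W) W then (b.orthogonal W).projection W h else 0

end LinearAlgebra

variable {E : Type*} [NormedAddCommGroup E] [NormedSpace ℝ E]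
  {M : Type*} [TopologicalSpace M] [ChartedSpace E M]
  {F : Type*} [NormedAddCommGroup F] [NormedSpace ℝ F]
  {S : Type*} [TopologicalSpace S] [ChartedSpace F S]

/-! ### Lorentzian metrics and their Levi-Civita derivative -/

variable (E M) in
/-- A smooth Lorentzian metric on a smooth manifold `M` modelled on `E`. -/
structure LorentzMetric [IsManifold 𝓘(ℝ, E) ∞ M] where
  /-- The scalar product on each tangent space. -/
  inner (x : M) : TangentSpace 𝓘(ℝ, E) x →L[ℝ] TangentSpace 𝓘(ℝ, E) x →L[ℝ] ℝ
  lorentz (x : M) : IsLorentzForm (inner x).toLinearMap₁₂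
  contMDiff : ContMDiff 𝓘(ℝ, E) (𝓘(ℝ, E).prod 𝓘(ℝ, E →L[ℝ] E →L[ℝ] ℝ)) ∞
    (fun x ↦ TotalSpace.mk' (E →L[ℝ] E →L[ℝ] ℝ) x (inner x))

namespace LorentzMetric

variable [IsManifold 𝓘(ℝ, E) ∞ M] (g : LorentzMetric E M)

/-- The scalar product at `x` as a bilinear form. -/
def form (x : M) : LinearMap.BilinForm ℝ (TangentSpace 𝓘(ℝ, E) x) := (g.inner x).toLinearMap₁₂

/-- The differential at `x` of the preferred chart around `x₀`. -/
def chartDeriv (x₀ x : M) : TangentSpace 𝓘(ℝ, E) x →L[ℝ] E :=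
  mfderiv 𝓘(ℝ, E) 𝓘(ℝ, E) (extChartAt 𝓘(ℝ, E) x₀) x

/-- The differential at `y` of the inverse of the preferred chart around `x₀`. -/
def chartSymmDeriv (x₀ : M) (y : E) :
    E →L[ℝ] TangentSpace 𝓘(ℝ, E) ((extChartAt 𝓘(ℝ, E) x₀).symm y) :=
  mfderiv 𝓘(ℝ, E) 𝓘(ℝ, E) (extChartAt 𝓘(ℝ, E) x₀).symm y

/-- The coordinate expression `y ↦ (g_{ab}(y))` of the metric in the preferred chart around `x₀`. -/
def chartMetric (x₀ : M) (y : E) : E →L[ℝ] E →L[ℝ] ℝ :=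
  (ContinuousLinearMap.precomp ℝ (chartSymmDeriv x₀ y)).comp
    ((g.inner ((extChartAt 𝓘(ℝ, E) x₀).symm y)).comp (chartSymmDeriv x₀ y))

/-- The covector `c ↦ ½ (∂_a g(b, c) + ∂_b g(a, c) - ∂_c g(a, b))` formed in the preferred chart
around `x₀` (Christoffel symbols of the first kind). -/
def christoffelFirst (x₀ : M) (y a b : E) : E →L[ℝ] ℝ :=
  (1 / 2 : ℝ) • (fderiv ℝ (g.chartMetric x₀) y a b + fderiv ℝ (g.chartMetric x₀) y b a
    - ((fderiv ℝ (g.chartMetric x₀) y).flip a).flip b)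

/-- The vector `Γ(a, b)` with `g(Γ(a, b), ·)` equal to `christoffelFirst`: the Christoffel symbols
`Γ^c_{ab}` of the Levi-Civita connection in the preferred chart around `x₀`. -/
def christoffel (x₀ : M) (y a b : E) : E :=
  (g.chartMetric x₀ y).inverse (g.christoffelFirst x₀ y a b)

/-- The derivative `∂_u h` of a vector-valued function `h : S → E` in the direction `u ∈ T_p S`. -/
def dirDeriv (h : S → E) (p : S) (u : TangentSpace 𝓘(ℝ, F) p) : E :=
  mfderiv 𝓘(ℝ, F) 𝓘(ℝ, E) h p u

/-- The Levi-Civita covariant derivative `∇_u W ∈ T_{f(p)} M` of a vector field `W` along a map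
`f : S → M` in the direction `u ∈ T_p S`. In the preferred chart around `f(p)` its components are
`∂_u W^c + Γ^c_{ab} (df(u))^a W^b`. -/
def covDerivAlong (f : S → M) (W : ∀ q : S, TangentSpace 𝓘(ℝ, E) (f q)) (p : S)
    (u : TangentSpace 𝓘(ℝ, F) p) : TangentSpace 𝓘(ℝ, E) (f p) :=
  (chartDeriv (f p) (f p)).inverse
    (dirDeriv (fun q ↦ chartDeriv (f p) (f q) (W q)) p u
      + g.christoffel (f p) (extChartAt 𝓘(ℝ, E) (f p) (f p))
          (chartDeriv (f p) (f p) (mfderiv 𝓘(ℝ, F) 𝓘(ℝ, E) f p u))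
          (chartDeriv (f p) (f p) (W p)))

/-- `γ` restricted to the open set `s` is an (affinely parametrized) geodesic: it is smooth on `s`
and `∇_{γ'} γ' = 0` there. -/
def IsGeodesicOn (γ : ℝ → M) (s : Set ℝ) : Prop :=
  ContMDiffOn 𝓘(ℝ, ℝ) 𝓘(ℝ, E) ∞ γ s ∧
    ∀ t ∈ s, g.covDerivAlong (F := ℝ) γ
      (fun r ↦ mfderiv 𝓘(ℝ, ℝ) 𝓘(ℝ, E) γ r (1 : ℝ)) t (1 : ℝ) = 0

/-! ### Immersed submanifolds

An immersed submanifold of `M` is given by a manifold `S` and an immersion `i : S → M`. -/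

/-- The induced scalar product on `T_p S`. -/
def inducedForm (i : S → M) (p : S) : LinearMap.BilinForm ℝ (TangentSpace 𝓘(ℝ, F) p) :=
  (g.form (i p)).comp (mfderiv 𝓘(ℝ, F) 𝓘(ℝ, E) i p).toLinearMap
    (mfderiv 𝓘(ℝ, F) 𝓘(ℝ, E) i p).toLinearMap

/-- The immersed submanifold is timelike: the induced scalar products are Lorentzian. -/
def IsTimelike (i : S → M) : Prop :=
  ∀ p : S, IsLorentzForm (g.inducedForm (F := F) i p)

/-- The immersed submanifold is nowhere spacelike: no induced scalar product is positive
definite. -/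
def IsNowhereSpacelike (i : S → M) : Prop :=
  ∀ p : S, ¬ ∀ w : TangentSpace 𝓘(ℝ, F) p, w ≠ 0 → 0 < g.inducedForm i p w w

/-- The immersed submanifold is a photon surface: it is nowhere spacelike, and for every lightlike
vector `w ∈ T_p S` the geodesic with initial velocity `w` is, for a short time, contained in the
submanifold, i.e. of the form `i ∘ σ` with a smooth curve `σ` in `S` with initial velocity `w`. -/
def IsPhotonSurface (i : S → M) : Prop :=
  g.IsNowhereSpacelike (F := F) i ∧
    ∀ (p : S) (w : TangentSpace 𝓘(ℝ, F) p), w ≠ 0 → g.inducedForm i p w w = 0 →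
      ∃ ε > (0 : ℝ), ∃ σ : ℝ → S,
        ContMDiffOn 𝓘(ℝ, ℝ) 𝓘(ℝ, F) ∞ σ (Set.Ioo (-ε) ε) ∧
        (⟨σ 0, mfderiv 𝓘(ℝ, ℝ) 𝓘(ℝ, F) σ 0 (1 : ℝ)⟩ : TangentBundle 𝓘(ℝ, F) S) = ⟨p, w⟩ ∧
        g.IsGeodesicOn (i ∘ σ) (Set.Ioo (-ε) ε)

/-- The tangent space of the immersed submanifold at `p`, as a subspace of `T_{i(p)} M`. -/
def tangentRange (i : S → M) (p : S) : Submodule ℝ (TangentSpace 𝓘(ℝ, E) (i p)) :=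
  LinearMap.range (mfderiv 𝓘(ℝ, F) 𝓘(ℝ, E) i p).toLinearMap

/-- The second fundamental form `Π(u, w) = P^⊥(∇_u w)` for vector fields `u`, `w` on `S`. -/
def secondFundamentalForm (i : S → M) (u w : ∀ p : S, TangentSpace 𝓘(ℝ, F) p) (p : S) :
    TangentSpace 𝓘(ℝ, E) (i p) :=
  perpProj (g.form (i p)) (tangentRange (F := F) i p)
    (g.covDerivAlong i (fun q ↦ mfderiv 𝓘(ℝ, F) 𝓘(ℝ, E) i q (w q)) p (u p))

/-- The immersed submanifold is totally umbilic: there is a smooth normal vector field `Z` along it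
such that `Π(u, w) = g(u, w) Z` for all smooth vector fields `u`, `w` on it. -/
def IsTotallyUmbilic [IsManifold 𝓘(ℝ, F) ∞ S] (i : S → M) : Prop :=
  ∃ Z : ∀ p : S, TangentSpace 𝓘(ℝ, E) (i p),
    ContMDiff 𝓘(ℝ, F) 𝓘(ℝ, E).tangent ∞
      (fun p ↦ (⟨i p, Z p⟩ : TangentBundle 𝓘(ℝ, E) M)) ∧
    (∀ p, Z p ∈ (g.form (i p)).orthogonal (tangentRange (F := F) i p)) ∧
    ∀ u w : ∀ p : S, TangentSpace 𝓘(ℝ, F) p,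
      ContMDiff 𝓘(ℝ, F) 𝓘(ℝ, F).tangent ∞ (fun p ↦ (⟨p, u p⟩ : TangentBundle 𝓘(ℝ, F) S)) →
      ContMDiff 𝓘(ℝ, F) 𝓘(ℝ, F).tangent ∞ (fun p ↦ (⟨p, w p⟩ : TangentBundle 𝓘(ℝ, F) S)) →
      ∀ p, g.secondFundamentalForm i u w p = g.inducedForm i p (u p) (w p) • Z p

end LorentzMetric

end PhotonSurface

end

/-! In charts the immersion becomes a map `ι` between vector spaces. The ambient derivative of a
tangential field `w` is `secondForm u w` plus the `ι'`-image of the coordinate derivative of `w`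
(`chartDeriv_covDerivAlong_tangential`). The second summand is tangent to the surface, so `Π` is the
symmetric bilinear map `secondForm` modulo the tangent space, and umbilicity becomes a pointwise
condition on it (`forall_secondFundamentalForm_eq_iff`).

From photon surface to umbilic: a geodesic of `M` inside the surface has zero acceleration, so
`secondForm w w` is tangential for every null `w`. A Lorentzian plane has two null directions, and a
symmetric bilinear map vanishing on both has only its mixed component left, as does the metric; so
it is a multiple of the metric (`IsLorentzForm.exists_smul_sub_smul_mem`). The multiple is `Z = Π(v,
v) / g(v, v)` for a timelike `v`. Keeping `v` constant in a chart shows that `Z` is smooth.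

From umbilic to photon surface: solve the geodesic equation of the induced metric with a null
initial velocity (`exists_induced_geodesic`). The velocity stays null, so `Π` vanishes on it by
umbilicity. The normal part of the ambient acceleration is then zero, and its tangential part is
zero by the equation. The curve is a geodesic of `M`. -/

namespace PhotonSurface

/-! ### Lorentzian planes and orthogonal projections -/

section LinearAlgebra

variable {V : Type*} [AddCommGroup V] [Module ℝ V]

/-- Such an `x` is orthogonal to the negative vector, where the form is positive definite, yet `b x
x = 0`. -/
theorem IsLorentzForm.eq_zero_of_forall_eq_zero {b : LinearMap.BilinForm ℝ V}
    (hb : IsLorentzForm b) {x : V} (hx : ∀ y, b x y = 0) : x = 0 := by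
  obtain ⟨v, -, hv⟩ := hb.signature
  by_contra hne
  have h := hv x (by rw [hb.symm]; exact hx v) hne
  rw [hx x] at h
  exact lt_irrefl _ h

/-- If a symmetric bilinear map on a Lorentzian plane takes values in a subspace `R` on all null
vectors, then modulo `R` it is a multiple of the scalar product. -/
theorem IsLorentzForm.exists_smul_sub_smul_mem {X : Type*} [AddCommGroup X] [Module ℝ X]
    {h : LinearMap.BilinForm ℝ V} (hh : IsLorentzForm h) (hdim : Module.finrank ℝ V = 2)
    {B : V →ₗ[ℝ] V →ₗ[ℝ] X} (hB : ∀ a b, B a b = B b a) {R : Submodule ℝ X}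
    (hR : ∀ w, w ≠ 0 → h w w = 0 → B w w ∈ R) :
    ∃ v, h v v < 0 ∧ ∀ a b, h v v • B a b - h a b • B v v ∈ R := by
  have : FiniteDimensional ℝ V := FiniteDimensional.of_finrank_pos (by omega)
  obtain ⟨v, hv, hpos⟩ := hh.signature
  have hv0 : v ≠ 0 := by
    rintro rfl
    simp at hv
  obtain ⟨n₀, hn₀⟩ : ∃ n₀, ¬ ∃ c : ℝ, c • v = n₀ := by
    by_contra hcon
    push Not at hcon
    have := (finrank_eq_one_iff_of_nonzero' v hv0).2 hcon
    omega
  set n : V := n₀ - (h v n₀ / h v v) • v with hn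
  have hvn : h v n = 0 := by
    simp only [hn, map_sub, map_smul, smul_eq_mul]
    rw [div_mul_cancel₀ _ hv.ne, sub_self]
  have hnv : h n v = 0 := by rw [hh.symm, hvn]
  have hn0 : n ≠ 0 := by
    intro h0
    exact hn₀ ⟨_, (sub_eq_zero.1 h0).symm⟩
  have hnn : 0 < h n n := hpos n hvn hn0
  have hdecomp : ∀ a, ∃ r s : ℝ, a = r • v + s • n := by
    have hli : LinearIndependent ℝ ![v, n] := by
      rw [LinearIndependent.pair_iff]
      intro r s hrs
      have h1 : h v (r • v + s • n) = 0 := by rw [hrs, map_zero]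
      have h2 : h n (r • v + s • n) = 0 := by rw [hrs, map_zero]
      simp only [map_add, map_smul, smul_eq_mul, hvn, hnv, mul_zero, add_zero, zero_add,
        mul_eq_zero] at h1 h2
      exact ⟨h1.resolve_right hv.ne, h2.resolve_right hnn.ne'⟩
    have hspan := hli.span_eq_top_of_card_eq_finrank' (by simp [hdim])
    intro a
    have ha : a ∈ Submodule.span ℝ (Set.range ![v, n]) := hspan ▸ Submodule.mem_top
    simp only [Matrix.range_cons, Matrix.range_empty, Set.union_empty, Set.singleton_union,
      Submodule.mem_span_pair] at ha
    obtain ⟨r, s, hrs⟩ := ha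
    exact ⟨r, s, hrs.symm⟩
  -- These lengths make `p • v ± q • n` null: `p² h(v,v) + q² h(n,n) = 0`. The sign is `e` below.
  set p := Real.sqrt (h n n) with hp
  set q := Real.sqrt (-h v v) with hq
  have hp2 : p * p = h n n := Real.mul_self_sqrt hnn.le
  have hq2 : q * q = -h v v := Real.mul_self_sqrt (by linarith)
  have hp0 : 0 < p := Real.sqrt_pos.2 hnn
  have hq0 : 0 < q := Real.sqrt_pos.2 (by linarith)
  have hnull : ∀ e : ℝ, e * e = 1 → B (p • v + (e * q) • n) (p • v + (e * q) • n) ∈ R := by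
    intro e he
    refine hR _ ?_ ?_
    · intro h0
      have h1 : h v (p • v + (e * q) • n) = 0 := by rw [h0, map_zero]
      simp only [map_add, map_smul, smul_eq_mul, hvn, mul_zero, add_zero, mul_eq_zero] at h1
      exact h1.elim hp0.ne' hv.ne
    · simp only [map_add, map_smul, LinearMap.add_apply, LinearMap.smul_apply, smul_eq_mul, hvn,
        hnv, mul_zero, add_zero, zero_add]
      linear_combination (h v v) * hp2 + (h n n) * (e * e) * hq2 - (h n n * h v v) * he
  have h1 := hnull 1 (by norm_num)
  have h2 := hnull (-1) (by norm_num)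
  simp only [map_add, map_smul, LinearMap.add_apply, LinearMap.smul_apply, hB n v] at h1 h2
  -- The values of `B` on the two null vectors differ by `4pq B(v,n)`; half their sum is the
  -- combination in `hsumR`.
  have hvnR : B v n ∈ R := by
    have := R.smul_mem (1 / (4 * (p * q))) (R.sub_mem h1 h2)
    convert this using 1
    have : p * q ≠ 0 := by positivity
    match_scalars <;> field_simp <;> ring
  have hsumR : h n n • B v v - h v v • B n n ∈ R := by
    have := R.smul_mem (1 / 2) (R.add_mem h1 h2)
    convert this using 1
    match_scalars
    · linear_combination -hp2
    · linear_combination -hq2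
    · ring
  refine ⟨v, hv, fun a b ↦ ?_⟩
  obtain ⟨a₁, a₂, rfl⟩ := hdecomp a
  obtain ⟨b₁, b₂, rfl⟩ := hdecomp b
  have := R.sub_mem (R.smul_mem (h v v * (a₁ * b₂ + a₂ * b₁)) hvnR) (R.smul_mem (a₂ * b₂) hsumR)
  convert this using 1
  simp only [map_add, map_smul, LinearMap.add_apply, LinearMap.smul_apply, smul_eq_mul, hvn, hnv,
    hB n v]
  match_scalars <;> ring

section Projection

variable {b : LinearMap.BilinForm ℝ V} {W : Submodule ℝ V}

/-- The orthogonal complement of a nondegenerate subspace of a finite-dimensional space is a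
complement. -/
theorem isCompl_orthogonal_of_restrict_injective (hb : ∀ v w, b v w = b w v)
    [FiniteDimensional ℝ V] (hW : ∀ x ∈ W, (∀ y ∈ W, b x y = 0) → x = 0) :
    IsCompl (b.orthogonal W) W := by
  refine (LinearMap.BilinForm.isCompl_orthogonal_of_restrict_nondegenerate
    (fun x y h ↦ by rw [hb, h]) ?_).symm
  refine ⟨?_, ?_⟩ <;> intro x hx <;> refine Subtype.ext (hW x x.2 fun y hy ↦ ?_)
  · exact hx ⟨y, hy⟩
  · rw [hb]
    exact hx ⟨y, hy⟩

theorem perpProj_mem_orthogonal (v : V) : perpProj b W v ∈ b.orthogonal W := by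
  unfold perpProj
  split_ifs with h
  · exact Submodule.projection_apply_mem h v
  · simp

theorem sub_perpProj_mem (h : IsCompl (b.orthogonal W) W) (v : V) : v - perpProj b W v ∈ W := by
  unfold perpProj
  rw [dif_pos h]
  have := Submodule.projection_add_projection_eq_self h v
  rw [sub_eq_iff_eq_add'.2 this.symm]
  exact Submodule.projection_apply_mem h.symm v

/-- This turns equations for `Π` into membership modulo the tangent space, so the projection never
has to be computed. -/
theorem perpProj_eq_iff (h : IsCompl (b.orthogonal W) W) {v z : V} (hz : z ∈ b.orthogonal W) :
    perpProj b W v = z ↔ v - z ∈ W := by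
  refine ⟨fun hv ↦ hv ▸ sub_perpProj_mem h v, fun hv ↦ ?_⟩
  refine sub_eq_zero.1 (h.disjoint.eq_bot.le
    ⟨Submodule.sub_mem _ (perpProj_mem_orthogonal v) hz, ?_⟩ : _ ∈ (⊥ : Submodule ℝ V))
  have := W.sub_mem hv (sub_perpProj_mem h v)
  simpa using this

end Projection

end LinearAlgebra

theorem _root_.ContinuousLinearMap.isInvertible_of_injective_dual {E : Type*}
    [NormedAddCommGroup E] [NormedSpace ℝ E] [FiniteDimensional ℝ E] {T : E →L[ℝ] E →L[ℝ] ℝ}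
    (hT : Function.Injective T) : T.IsInvertible := by
  have hdim : Module.finrank ℝ E = Module.finrank ℝ (E →L[ℝ] ℝ) := by
    rw [← (LinearMap.toContinuousLinearMap (𝕜 := ℝ) (E := E) (F' := ℝ)).finrank_eq]
    exact (Subspace.dual_finrank_eq (K := ℝ) (V := E)).symm
  let e := LinearEquiv.ofInjectiveOfFinrankEq T.toLinearMap hT hdim
  exact ⟨e.toContinuousLinearEquiv, by ext; rfl⟩

end PhotonSurface

noncomputable section

namespace PhotonSurface

/-! ### Christoffel symbols of a metric on a vector space -/

section Coordinates

set_option maxSynthPendingDepth 3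

variable {E : Type*} [NormedAddCommGroup E] [NormedSpace ℝ E]
  {F : Type*} [NormedAddCommGroup F] [NormedSpace ℝ F]

theorem minSmoothness_two_le_infty : minSmoothness ℝ 2 ≤ (∞ : WithTop ℕ∞) := by
  rw [minSmoothness_of_isRCLikeNormedField]
  exact WithTop.coe_le_coe.2 le_top

/-- The Christoffel symbols of a metric `G` on an open subset of a vector space. -/
def christoffelOf (G : E → E →L[ℝ] E →L[ℝ] ℝ) (y a b : E) : E :=
  (G y).inverse ((1 / 2 : ℝ) • (fderiv ℝ G y a b + fderiv ℝ G y b a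
    - ((fderiv ℝ G y).flip a).flip b))

variable {G : E → E →L[ℝ] E →L[ℝ] ℝ} {y : E}

theorem apply_christoffelOf (hG : (G y).IsInvertible) (a b c : E) :
    G y (christoffelOf G y a b) c =
      (1 / 2) * (fderiv ℝ G y a b c + fderiv ℝ G y b a c - fderiv ℝ G y c a b) := by
  rw [christoffelOf, hG.self_apply_inverse]
  simp

/-- Evaluation at `a` and `b` is continuous linear and commutes with differentiation, so symmetry
near `y` passes to the derivative. -/
theorem fderiv_apply_comm (hd : DifferentiableAt ℝ G y)
    (hs : ∀ᶠ z in 𝓝 y, ∀ a b, G z a b = G z b a) (c a b : E) :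
    fderiv ℝ G y c a b = fderiv ℝ G y c b a := by
  have key : ∀ a b : E, HasFDerivAt (fun z ↦ G z a b)
      (((ContinuousLinearMap.apply ℝ ℝ b).comp (ContinuousLinearMap.apply ℝ _ a)).comp
        (fderiv ℝ G y)) y := fun a b ↦
    ((ContinuousLinearMap.apply ℝ ℝ b).comp
      (ContinuousLinearMap.apply ℝ (E →L[ℝ] ℝ) a)).hasFDerivAt.comp y hd.hasFDerivAt
  have h := (key a b).unique ((key b a).congr_of_eventuallyEq (hs.mono fun z hz ↦ hz a b))
  exact congrArg (fun T ↦ T c) h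

variable (G y) in
/-- The Christoffel symbols as a bilinear map. -/
def christoffelBilin : E →ₗ[ℝ] E →ₗ[ℝ] E :=
  LinearMap.mk₂ ℝ (christoffelOf G y)
    (fun a a' b ↦ by
      simp only [christoffelOf, map_add, ← map_add (G y).inverse, add_apply,
        ContinuousLinearMap.flip_add, ← smul_add]
      congr 2; abel)
    (fun r a b ↦ by
      simp only [christoffelOf, map_smul, smul_apply,
        ContinuousLinearMap.flip_smul, ← smul_add, ← smul_sub, smul_comm _ r])
    (fun a b b' ↦ by
      simp only [christoffelOf, map_add, ← map_add (G y).inverse, add_apply,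
        ← smul_add]
      congr 2; abel)
    (fun r a b ↦ by
      simp only [christoffelOf, map_smul, smul_apply,
        ← smul_add, ← smul_sub, smul_comm _ r])

theorem christoffelOf_comm (hd : DifferentiableAt ℝ G y)
    (hs : ∀ᶠ z in 𝓝 y, ∀ a b, G z a b = G z b a) (a b : E) :
    christoffelOf G y a b = christoffelOf G y b a := by
  simp only [christoffelOf]
  congr 2
  ext c
  simp only [sub_apply, add_apply,
    ContinuousLinearMap.flip_apply]
  rw [fderiv_apply_comm hd hs c a b, add_comm]

/-- The transformation law of the Christoffel symbols under a change of coordinates `θ`. -/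
theorem fderiv_christoffelOf {E' : Type*} [NormedAddCommGroup E'] [NormedSpace ℝ E']
    {G' : E' → E' →L[ℝ] E' →L[ℝ] ℝ} {θ : E → E'} (hθ : ContDiffAt ℝ ∞ θ y)
    (hG' : DifferentiableAt ℝ G' (θ y)) (hGG' : ∀ᶠ z in 𝓝 y, ∀ a b,
      G z a b = G' (θ z) (fderiv ℝ θ z a) (fderiv ℝ θ z b))
    (hd : DifferentiableAt ℝ G y)
    (hs : ∀ᶠ z in 𝓝 (θ y), ∀ a b, G' z a b = G' z b a)
    (hi : (G y).IsInvertible) (hi' : (G' (θ y)).IsInvertible)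
    (hsurj : Function.Surjective (fderiv ℝ θ y)) (a b : E) :
    fderiv ℝ θ y (christoffelOf G y a b) =
      christoffelOf G' (θ y) (fderiv ℝ θ y a) (fderiv ℝ θ y b)
        + fderiv ℝ (fderiv ℝ θ) y a b := by
  have hθd : DifferentiableAt ℝ θ y := hθ.differentiableAt (by simp)
  have hθ2 : DifferentiableAt ℝ (fderiv ℝ θ) y :=
    (hθ.fderiv_right (m := ∞) (by simp)).differentiableAt (by simp)
  have hsymm : ∀ a b, fderiv ℝ (fderiv ℝ θ) y a b = fderiv ℝ (fderiv ℝ θ) y b a :=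
    (hθ.isSymmSndFDerivAt minSmoothness_two_le_infty).eq
  have hs0 : ∀ a b, G' (θ y) a b = G' (θ y) b a := hs.self_of_nhds
  -- Product rule applied to the pullback identity `G = θ^* G'`.
  have hDG : ∀ a b c, fderiv ℝ G y c a b =
      fderiv ℝ G' (θ y) (fderiv ℝ θ y c) (fderiv ℝ θ y a) (fderiv ℝ θ y b)
        + G' (θ y) (fderiv ℝ (fderiv ℝ θ) y c a) (fderiv ℝ θ y b)
        + G' (θ y) (fderiv ℝ θ y a) (fderiv ℝ (fderiv ℝ θ) y c b) := by
    intro a b c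
    have h1 : HasFDerivAt (fun z ↦ G z a b)
        (((ContinuousLinearMap.apply ℝ ℝ b).comp (ContinuousLinearMap.apply ℝ _ a)).comp
          (fderiv ℝ G y)) y :=
      ((ContinuousLinearMap.apply ℝ ℝ b).comp
        (ContinuousLinearMap.apply ℝ (E →L[ℝ] ℝ) a)).hasFDerivAt.comp y hd.hasFDerivAt
    have hap : ∀ a : E, HasFDerivAt (fun z ↦ fderiv ℝ θ z a)
        ((ContinuousLinearMap.apply ℝ E' a).comp (fderiv ℝ (fderiv ℝ θ) y)) y := fun a ↦
      (ContinuousLinearMap.apply ℝ E' a).hasFDerivAt.comp y hθ2.hasFDerivAt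
    have h2 := ((hG'.hasFDerivAt.comp y hθd.hasFDerivAt).clm_apply (hap a)).clm_apply (hap b)
    have h3 := h1.unique (h2.congr_of_eventuallyEq (hGG'.mono fun z hz ↦ hz a b))
    have h4 := congrArg (fun T ↦ T c) h3
    simp at h4
    rw [h4]
    ring
  -- As `G'` is nondegenerate and `θ'` is surjective, it suffices to pair both sides with vectors
  -- `θ' c`. In the Koszul combination the second-derivative terms involving `c` cancel by symmetry,
  -- and `G'(θ''(a,b), θ' c)` remains.
  obtain ⟨e, he⟩ := hi'
  refine e.injective ?_
  have : ∀ x, e x = G' (θ y) x := fun x ↦ by rw [← he]; rfl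
  rw [this, this]
  ext d
  obtain ⟨c, rfl⟩ := hsurj d
  rw [← hGG'.self_of_nhds, apply_christoffelOf hi, map_add, add_apply,
    apply_christoffelOf ⟨e, he⟩, hDG, hDG, hDG, hsymm c a, hsymm b a, hsymm c b,
    hs0 (fderiv ℝ θ y a), hs0 (fderiv ℝ θ y b)]
  ring

/-- Inversion is smooth at invertible maps. Smoothness is joint in the point and both arguments
because the geodesic equation varies them together. -/
theorem contDiffAt_christoffelOf [FiniteDimensional ℝ E] (hG : ContDiffAt ℝ ∞ G y)
    (hi : (G y).IsInvertible) (a b : E) :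
    ContDiffAt ℝ ∞ (fun z : E × E × E ↦ christoffelOf G z.1 z.2.1 z.2.2) (y, a, b) := by
  have hG1 : ContDiffAt ℝ ∞ (fun z : E × E × E ↦ G z.1) (y, a, b) :=
    hG.comp (y, a, b) contDiffAt_fst
  have hD : ContDiffAt ℝ ∞ (fun z : E × E × E ↦ fderiv ℝ G z.1) (y, a, b) :=
    (hG.fderiv_right (m := ∞) (by simp)).comp (y, a, b) contDiffAt_fst
  have hinv : ContDiffAt ℝ ∞ (fun z : E × E × E ↦ (G z.1).inverse) (y, a, b) :=
    ContDiffAt.comp (y, a, b) (g := ContinuousLinearMap.inverse) hi.contDiffAt_map_inverse hG1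
  have ha : ContDiffAt ℝ ∞ (fun z : E × E × E ↦ z.2.1) (y, a, b) := by fun_prop
  have hb : ContDiffAt ℝ ∞ (fun z : E × E × E ↦ z.2.2) (y, a, b) := by fun_prop
  have hfl : ContDiffAt ℝ ∞ (fun z : E × E × E ↦ (fderiv ℝ G z.1).flip) (y, a, b) :=
    (ContinuousLinearMap.flipₗᵢ ℝ E E (E →L[ℝ] ℝ)).contDiff.contDiffAt.comp (y, a, b) hD
  have hfl2 : ContDiffAt ℝ ∞ (fun z : E × E × E ↦ ((fderiv ℝ G z.1).flip z.2.1).flip) (y, a, b) :=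
    (ContinuousLinearMap.flipₗᵢ ℝ E E ℝ).contDiff.contDiffAt.comp (y, a, b) (hfl.clm_apply ha)
  exact hinv.clm_apply ((((hD.clm_apply ha).clm_apply hb).add
    ((hD.clm_apply hb).clm_apply ha)).sub (hfl2.clm_apply hb) |>.const_smul (1 / 2 : ℝ))

/-! ### Submanifolds in coordinates -/

variable (G) (ι : F → E)

/-- The part of the coordinate expression of `∇_a b`, for vector fields `a`, `b` tangent to the
immersion `ι`, which does not involve derivatives of `b`. -/
def secondForm (y a b : F) : E :=
  fderiv ℝ (fderiv ℝ ι) y a b + christoffelOf G (ι y) (fderiv ℝ ι y a) (fderiv ℝ ι y b)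

/-- `secondForm` as a bilinear map. -/
def secondFormBilin (y : F) : F →ₗ[ℝ] F →ₗ[ℝ] E :=
  (fderiv ℝ (fderiv ℝ ι) y).toLinearMap₁₂ +
    (christoffelBilin G (ι y)).compl₁₂ (fderiv ℝ ι y).toLinearMap (fderiv ℝ ι y).toLinearMap

/-- The metric induced by `G` along `ι`. -/
def pullbackMetric (y : F) : F →L[ℝ] F →L[ℝ] ℝ :=
  (ContinuousLinearMap.precomp ℝ (fderiv ℝ ι y)).comp ((G (ι y)).comp (fderiv ℝ ι y))

theorem pullbackMetric_apply (y a b : F) :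
    pullbackMetric G ι y a b = G (ι y) (fderiv ℝ ι y a) (fderiv ℝ ι y b) := rfl

/-- The coordinates of the orthogonal projection of `e` to the tangent space of `ι`. -/
def tangentCoord (y : F) (e : E) : F :=
  (pullbackMetric G ι y).inverse (ContinuousLinearMap.precomp ℝ (fderiv ℝ ι y) (G (ι y) e))

variable {G ι} {y : F}

theorem apply_fderiv_tangentCoord (hi : (pullbackMetric G ι y).IsInvertible) (e : E) (a : F) :
    G (ι y) (fderiv ℝ ι y (tangentCoord G ι y e)) (fderiv ℝ ι y a) =
      G (ι y) e (fderiv ℝ ι y a) := by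
  rw [← pullbackMetric_apply, tangentCoord, hi.self_apply_inverse]
  rfl

/-- The induced metric is nondegenerate, so pairings with tangent vectors determine the tangential
part. -/
theorem tangentCoord_eq (hi : (pullbackMetric G ι y).IsInvertible) {e : E} {c : F}
    (h : ∀ a, G (ι y) e (fderiv ℝ ι y a) = G (ι y) (fderiv ℝ ι y c) (fderiv ℝ ι y a)) :
    tangentCoord G ι y e = c := by
  have : ContinuousLinearMap.precomp ℝ (fderiv ℝ ι y) (G (ι y) e) = pullbackMetric G ι y c := by
    ext a
    exact h a
  rw [tangentCoord, this, hi.inverse_apply_self]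

/-- Symmetry of second derivatives together with torsion-freeness. It is what allows null vectors
alone to control the whole map. -/
theorem secondForm_comm (hι : ContDiffAt ℝ ∞ ι y) (hd : DifferentiableAt ℝ G (ι y))
    (hs : ∀ᶠ z in 𝓝 (ι y), ∀ a b, G z a b = G z b a) (a b : F) :
    secondForm G ι y a b = secondForm G ι y b a := by
  rw [secondForm, secondForm, (hι.isSymmSndFDerivAt minSmoothness_two_le_infty).eq,
    christoffelOf_comm hd hs]

theorem contDiffAt_secondForm [FiniteDimensional ℝ E] (hι : ContDiffAt ℝ ∞ ι y)
    (hG : ContDiffAt ℝ ∞ G (ι y)) (hi : (G (ι y)).IsInvertible) (a b : F) :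
    ContDiffAt ℝ ∞ (fun z : F × F × F ↦ secondForm G ι z.1 z.2.1 z.2.2) (y, a, b) := by
  have hD1 : ContDiffAt ℝ ∞ (fderiv ℝ ι) y := hι.fderiv_right (by simp)
  have hD2 : ContDiffAt ℝ ∞ (fderiv ℝ (fderiv ℝ ι)) y := hD1.fderiv_right (by simp)
  have h0 : ContDiffAt ℝ ∞ (fun z : F × F × F ↦ ι z.1) (y, a, b) :=
    hι.comp (y, a, b) contDiffAt_fst
  have h1 : ContDiffAt ℝ ∞ (fun z : F × F × F ↦ fderiv ℝ ι z.1) (y, a, b) :=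
    hD1.comp (y, a, b) contDiffAt_fst
  have h2 : ContDiffAt ℝ ∞ (fun z : F × F × F ↦ fderiv ℝ (fderiv ℝ ι) z.1) (y, a, b) :=
    hD2.comp (y, a, b) contDiffAt_fst
  have ha : ContDiffAt ℝ ∞ (fun z : F × F × F ↦ z.2.1) (y, a, b) := by fun_prop
  have hb : ContDiffAt ℝ ∞ (fun z : F × F × F ↦ z.2.2) (y, a, b) := by fun_prop
  refine ((h2.clm_apply ha).clm_apply hb).add ?_
  exact (contDiffAt_christoffelOf hG hi (fderiv ℝ ι y a) (fderiv ℝ ι y b)).comp (y, a, b)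
    (h0.prodMk ((h1.clm_apply ha).prodMk (h1.clm_apply hb)))

theorem contDiffAt_pullbackMetric (hι : ContDiffAt ℝ ∞ ι y) (hG : ContDiffAt ℝ ∞ G (ι y)) :
    ContDiffAt ℝ ∞ (pullbackMetric G ι) y := by
  have hD1 : ContDiffAt ℝ ∞ (fderiv ℝ ι) y := hι.fderiv_right (by simp)
  have h : ContDiffAt ℝ ∞ (fun z ↦ G (ι z)) y := hG.comp y hι
  have hp : ContDiffAt ℝ ∞ (fun z ↦ ContinuousLinearMap.precomp ℝ (fderiv ℝ ι z)) y :=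
    ((ContinuousLinearMap.compL ℝ F E ℝ).flip).contDiff.contDiffAt.comp y hD1
  exact hp.clm_comp (h.clm_comp hD1)

theorem contDiffAt_tangentCoord [FiniteDimensional ℝ F] (hι : ContDiffAt ℝ ∞ ι y)
    (hG : ContDiffAt ℝ ∞ G (ι y)) (hi : (pullbackMetric G ι y).IsInvertible) (e : E) :
    ContDiffAt ℝ ∞ (fun z : F × E ↦ tangentCoord G ι z.1 z.2) (y, e) := by
  have hD1 : ContDiffAt ℝ ∞ (fderiv ℝ ι) y := hι.fderiv_right (by simp)
  have h : ContDiffAt ℝ ∞ (fun z ↦ G (ι z)) y := hG.comp y hι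
  have hp : ContDiffAt ℝ ∞ (fun z ↦ ContinuousLinearMap.precomp ℝ (fderiv ℝ ι z)) y :=
    ((ContinuousLinearMap.compL ℝ F E ℝ).flip).contDiff.contDiffAt.comp y hD1
  have hinv : ContDiffAt ℝ ∞ (fun z ↦ (pullbackMetric G ι z).inverse) y :=
    ContDiffAt.comp y (g := ContinuousLinearMap.inverse) hi.contDiffAt_map_inverse
      (contDiffAt_pullbackMetric hι hG)
  have hfst : ContDiffAt ℝ ∞ (Prod.fst : F × E → F) (y, e) := contDiffAt_fst
  exact (hinv.comp (y, e) hfst).clm_apply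
    ((hp.comp (y, e) hfst).clm_apply ((h.comp (y, e) hfst).clm_apply contDiffAt_snd))

/-! ### Geodesics of the induced metric -/

/-- Integral curves of smooth vector fields exist for short time, and are smooth. -/
theorem exists_contDiffOn_integralCurve [CompleteSpace E] {f : E → E} {U : Set E} (hU : IsOpen U)
    (hf : ContDiffOn ℝ ∞ f U) {x : E} (hx : x ∈ U) :
    ∃ ε > (0 : ℝ), ∃ α : ℝ → E, α 0 = x ∧ ContDiffOn ℝ ∞ α (Set.Ioo (-ε) ε) ∧
      ∀ t ∈ Set.Ioo (-ε) ε, α t ∈ U ∧ HasDerivAt α (f (α t)) t := by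
  obtain ⟨α, hα0, ε, hε, hα⟩ :=
    ((hf.contDiffAt (hU.mem_nhds hx)).of_le (by simp) :
      ContDiffAt ℝ 1 f x).exists_forall_mem_closedBall_exists_eq_forall_mem_Ioo_hasDerivAt₀ 0
  have hc : ContinuousAt α 0 := (hα 0 (by constructor <;> linarith)).continuousAt
  have hmem : ∀ᶠ t in 𝓝 (0 : ℝ), α t ∈ U := hc.eventually_mem (by rw [hα0]; exact hU.mem_nhds hx)
  obtain ⟨δ, hδ, hδU⟩ := Metric.eventually_nhds_iff.1 hmem
  -- Halving puts the closed interval strictly inside both the existence interval and the time spent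
  -- in `U`; the regularity bootstrap below works on a closed interval.
  set η := min ε δ / 2 with hη
  have hη0 : 0 < η := by positivity
  have hηε : η < ε := by
    have := min_le_left ε δ
    linarith
  have hηδ : η < δ := by
    have := min_le_right ε δ
    linarith
  have hU' : ∀ t ∈ Set.Icc (-η) η, α t ∈ U := fun t ht ↦ hδU (by
    rw [Real.dist_eq, sub_zero]
    exact (abs_le.2 ht).trans_lt hηδ)
  have hd : ∀ t ∈ Set.Icc (-η) η, HasDerivAt α (f (α t)) t := fun t ht ↦
    hα t ⟨by linarith [ht.1], by linarith [ht.2]⟩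
  refine ⟨η, hη0, α, hα0, ?_, fun t ht ↦ ⟨hU' t (Set.Ioo_subset_Icc_self ht),
    hd t (Set.Ioo_subset_Icc_self ht)⟩⟩
  refine ContDiffOn.mono (ODE.contDiffOn_enat_Icc_of_hasDerivWithinAt (n := ⊤) (f := fun _ ↦ f)
    (u := U) ?_ (fun t ht ↦ (hd t ht).hasDerivWithinAt) hU') Set.Ioo_subset_Icc_self
  exact hf.comp contDiff_snd.contDiffOn fun z hz ↦ hz.2

/-- Short-time existence of geodesics of the induced metric, along which the scalar square of the
velocity is constant. -/
theorem exists_induced_geodesic [FiniteDimensional ℝ E] [FiniteDimensional ℝ F] {U : Set F}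
    (hU : IsOpen U) (hι : ∀ y ∈ U, ContDiffAt ℝ ∞ ι y) (hG : ∀ y ∈ U, ContDiffAt ℝ ∞ G (ι y))
    (hs : ∀ y ∈ U, ∀ a b, G (ι y) a b = G (ι y) b a)
    (hi : ∀ y ∈ U, (G (ι y)).IsInvertible) (hp : ∀ y ∈ U, (pullbackMetric G ι y).IsInvertible)
    (hy : y ∈ U) (w : F) :
    ∃ ε > (0 : ℝ), ∃ s v : ℝ → F, s 0 = y ∧ v 0 = w ∧ ContDiffOn ℝ ∞ s (Set.Ioo (-ε) ε) ∧
      ∀ t ∈ Set.Ioo (-ε) ε, s t ∈ U ∧ HasDerivAt s (v t) t ∧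
        HasDerivAt v (-tangentCoord G ι (s t) (secondForm G ι (s t) (v t) (v t))) t ∧
        pullbackMetric G ι (s t) (v t) (v t) = pullbackMetric G ι y w w := by
  -- The geodesic equation as a first-order system for position and velocity: the coordinate
  -- acceleration cancels the tangential part of `secondForm`.
  let f : F × F → F × F :=
    fun z ↦ (z.2, -tangentCoord G ι z.1 (secondForm G ι z.1 z.2 z.2))
  have hf : ContDiffOn ℝ ∞ f (U ×ˢ Set.univ) := by
    rintro ⟨y, v⟩ ⟨hy, -⟩
    refine ContDiffAt.contDiffWithinAt ?_
    have h1 : ContDiffAt ℝ ∞ (fun z : F × F ↦ secondForm G ι z.1 z.2 z.2) (y, v) :=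
      (contDiffAt_secondForm (hι y hy) (hG y hy) (hi y hy) v v).comp (y, v)
        (contDiffAt_fst.prodMk (contDiffAt_snd.prodMk contDiffAt_snd))
    have h2 := (contDiffAt_tangentCoord (hι y hy) (hG y hy) (hp y hy)
      (secondForm G ι y v v)).comp (y, v) (contDiffAt_fst.prodMk h1)
    exact contDiffAt_snd.prodMk h2.neg
  obtain ⟨ε, hε, α, hα0, hαs, hα⟩ := exists_contDiffOn_integralCurve
    (hU.prod isOpen_univ) hf (x := (y, w)) ⟨hy, Set.mem_univ _⟩
  have hsd : ∀ t ∈ Set.Ioo (-ε) ε, HasDerivAt (fun t ↦ (α t).1) (α t).2 t := fun t ht ↦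
    (hα t ht).2.fst
  have hvd : ∀ t ∈ Set.Ioo (-ε) ε, HasDerivAt (fun t ↦ (α t).2)
      (-tangentCoord G ι (α t).1 (secondForm G ι (α t).1 (α t).2 (α t).2)) t := fun t ht ↦
    (hα t ht).2.snd
  -- The derivative is twice the product of ambient acceleration and velocity, and the acceleration
  -- is normal. In coordinates, the derivative of `G` enters through `G(Γ(x,x), x) = ½ (∂_x
  -- G)(x,x)`.
  have hconst : ∀ t ∈ Set.Ioo (-ε) ε,
      HasDerivAt (fun t ↦ pullbackMetric G ι (α t).1 (α t).2 (α t).2) 0 t := by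
    intro t ht
    obtain ⟨⟨htU, -⟩, -⟩ := hα t ht
    set q := (α t).1 with hq
    set v := (α t).2 with hv
    have hD1 : DifferentiableAt ℝ (fderiv ℝ ι) q :=
      ((hι q htU).fderiv_right (m := ∞) (by simp)).differentiableAt (by simp)
    have hιd : HasDerivAt (fun t ↦ ι (α t).1) (fderiv ℝ ι q v) t :=
      ((hι q htU).differentiableAt (by simp)).hasFDerivAt.comp_hasDerivAt t (hsd t ht)
    have hGd : HasDerivAt (fun t ↦ G (ι (α t).1)) (fderiv ℝ G (ι q) (fderiv ℝ ι q v)) t :=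
      HasFDerivAt.comp_hasDerivAt t
        ((hG q htU).differentiableAt (by simp)).hasFDerivAt hιd
    have hDd : HasDerivAt (fun t ↦ fderiv ℝ ι (α t).1) (fderiv ℝ (fderiv ℝ ι) q v) t :=
      hD1.hasFDerivAt.comp_hasDerivAt t (hsd t ht)
    have hxd := hDd.clm_apply (hvd t ht)
    have := (hGd.clm_apply hxd).clm_apply hxd
    simp only [add_apply, ← hq, ← hv] at this
    refine this.congr_deriv ?_
    have hchr := apply_christoffelOf (hi q htU) (fderiv ℝ ι q v) (fderiv ℝ ι q v) (fderiv ℝ ι q v)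
    have htan := apply_fderiv_tangentCoord (hp q htU) (secondForm G ι q v v) v
    rw [secondForm, map_add (G (ι q)), add_apply, hchr] at htan
    rw [hs q htU (fderiv ℝ ι q v), map_neg, map_add, add_apply, map_neg,
      neg_apply, secondForm, htan]
    ring
  refine ⟨ε, hε, fun t ↦ (α t).1, fun t ↦ (α t).2, by simp [hα0], by simp [hα0], hαs.fst,
    fun t ht ↦ ⟨(hα t ht).1.1, hsd t ht, hvd t ht, ?_⟩⟩
  have h0 : (0 : ℝ) ∈ Set.Ioo (-ε) ε := ⟨by linarith, hε⟩
  have := isOpen_Ioo.is_const_of_deriv_eq_zero (convex_Ioo (-ε) ε).isPreconnected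
    (fun t ht ↦ (hconst t ht).differentiableAt.differentiableWithinAt)
    (fun t ht ↦ (hconst t ht).deriv) ht h0
  simpa only [hα0] using this

end Coordinates

end PhotonSurface

end

noncomputable section

namespace PhotonSurface

namespace LorentzMetric

set_option maxSynthPendingDepth 3

variable {E : Type*} [NormedAddCommGroup E] [NormedSpace ℝ E]
  {M : Type*} [TopologicalSpace M] [ChartedSpace E M]
  {F : Type*} [NormedAddCommGroup F] [NormedSpace ℝ F]
  {S : Type*} [TopologicalSpace S] [ChartedSpace F S]

/-! ### Charts and tangent vectors -/

section Charts

variable {N : Type*} [TopologicalSpace N] [ChartedSpace F N]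
  [IsManifold 𝓘(ℝ, E) ∞ M] {x₀ x : M}

theorem isManifold_one : IsManifold 𝓘(ℝ, E) 1 M := IsManifold.of_le (n := ∞) (by simp)

attribute [local instance] isManifold_one

theorem isInvertible_chartDeriv (hx : x ∈ (chartAt E x₀).source) :
    (chartDeriv (E := E) x₀ x).IsInvertible :=
  isInvertible_mfderiv_extChartAt (by rwa [extChartAt_source])

theorem chartDeriv_surjective (hx : x ∈ (chartAt E x₀).source) :
    Function.Surjective (chartDeriv (E := E) x₀ x) := fun a ↦
  ⟨_, (isInvertible_chartDeriv hx).self_apply_inverse a⟩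

theorem chartDeriv_injective (hx : x ∈ (chartAt E x₀).source) :
    Function.Injective (chartDeriv (E := E) x₀ x) :=
  (isInvertible_chartDeriv hx).injective

theorem chartSymmDeriv_chartDeriv {y : E} (hy : y ∈ (extChartAt 𝓘(ℝ, E) x₀).target)
    (v : TangentSpace 𝓘(ℝ, E) ((extChartAt 𝓘(ℝ, E) x₀).symm y)) :
    chartSymmDeriv x₀ y (chartDeriv x₀ ((extChartAt 𝓘(ℝ, E) x₀).symm y) v) = v := by
  have h := mfderivWithin_extChartAt_symm_comp_mfderiv_extChartAt (I := 𝓘(ℝ, E)) hy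
  rw [modelWithCornersSelf_coe, Set.range_id, mfderivWithin_univ] at h
  exact congrArg (fun T ↦ T v) h

theorem chartDeriv_chartSymmDeriv {y : E} (hy : y ∈ (extChartAt 𝓘(ℝ, E) x₀).target) (a : E) :
    chartDeriv x₀ ((extChartAt 𝓘(ℝ, E) x₀).symm y) (chartSymmDeriv x₀ y a) = a := by
  have h := mfderiv_extChartAt_comp_mfderivWithin_extChartAt_symm (I := 𝓘(ℝ, E)) hy
  rw [modelWithCornersSelf_coe, Set.range_id, mfderivWithin_univ] at h
  exact congrArg (fun T ↦ T a) h

/-- Smoothness of a vector field along a map, in terms of its coordinates in a chart. -/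
theorem contMDiffAt_tangentBundle_iff {b : N → M} {v : ∀ q, TangentSpace 𝓘(ℝ, E) (b q)} {q₀ : N}
    (hq : b q₀ ∈ (chartAt E x₀).source) :
    ContMDiffAt 𝓘(ℝ, F) 𝓘(ℝ, E).tangent ∞ (fun q ↦ (⟨b q, v q⟩ : TangentBundle 𝓘(ℝ, E) M)) q₀ ↔
      ContMDiffAt 𝓘(ℝ, F) 𝓘(ℝ, E) ∞ b q₀ ∧
        ContMDiffAt 𝓘(ℝ, F) 𝓘(ℝ, E) ∞ (fun q ↦ chartDeriv x₀ (b q) (v q)) q₀ := by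
  rw [(trivializationAt E (TangentSpace 𝓘(ℝ, E)) x₀).contMDiffAt_iff (by
    rw [Trivialization.mem_source]; simpa using hq)]
  refine and_congr_right fun hb ↦ ?_
  refine Filter.EventuallyEq.contMDiffAt_iff ?_
  have : ∀ᶠ q in 𝓝 q₀, b q ∈ (chartAt E x₀).source :=
    hb.continuousAt.eventually_mem ((chartAt E x₀).open_source.mem_nhds hq)
  filter_upwards [this] with q hq
  rw [chartDeriv, ← TangentBundle.continuousLinearMapAt_trivializationAt hq,
    Trivialization.continuousLinearMapAt_apply, Trivialization.linearMapAt_apply]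
  rw [if_pos (by simpa using hq)]

theorem contDiffAt_coordChange {x₁ : M} (h₀ : x ∈ (chartAt E x₀).source)
    (h₁ : x ∈ (chartAt E x₁).source) :
    ContDiffAt ℝ ∞ (extChartAt 𝓘(ℝ, E) x₁ ∘ (extChartAt 𝓘(ℝ, E) x₀).symm)
      (extChartAt 𝓘(ℝ, E) x₀ x) := by
  have h := contDiffWithinAt_ext_coord_change (I := 𝓘(ℝ, E)) (n := ∞) x₁ x₀
    (y := extChartAt 𝓘(ℝ, E) x₀ x) (by simp [h₀, h₁])
  rwa [modelWithCornersSelf_coe, Set.range_id, contDiffWithinAt_univ] at h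

theorem dirDeriv_comp {B : Type*} [NormedAddCommGroup B] [NormedSpace ℝ B] {f : E → B}
    {X : N → E} {q : N} (hf : DifferentiableAt ℝ f (X q))
    (hX : MDifferentiableAt 𝓘(ℝ, F) 𝓘(ℝ, E) X q) (u : TangentSpace 𝓘(ℝ, F) q) :
    dirDeriv (fun r ↦ f (X r)) q u = fderiv ℝ f (X q) (dirDeriv X q u) := by
  have := mfderiv_comp q hf.mdifferentiableAt hX
  rw [mfderiv_eq_fderiv] at this
  exact congrArg (fun T ↦ T u) this

theorem dirDeriv_congr {X Y : N → E} {q : N} (h : X =ᶠ[𝓝 q] Y) (u : TangentSpace 𝓘(ℝ, F) q) :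
    dirDeriv X q u = dirDeriv Y q u := by
  rw [dirDeriv, dirDeriv, h.mfderiv_eq]
  rfl

theorem dirDeriv_clm_apply {B : Type*} [NormedAddCommGroup B] [NormedSpace ℝ B]
    {A : Type*} [NormedAddCommGroup A] [NormedSpace ℝ A] {T : E → A →L[ℝ] B}
    {X : N → E} {w : N → A} {q : N} (hT : DifferentiableAt ℝ T (X q))
    (hX : MDifferentiableAt 𝓘(ℝ, F) 𝓘(ℝ, E) X q) (hw : MDifferentiableAt 𝓘(ℝ, F) 𝓘(ℝ, A) w q)
    (u : TangentSpace 𝓘(ℝ, F) q) :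
    dirDeriv (fun r ↦ T (X r) (w r)) q u =
      fderiv ℝ T (X q) (dirDeriv X q u) (w q) + T (X q) (dirDeriv w q u) := by
  have hpair := hX.prodMk_space hw
  -- The derivative of the pair is read off from the chain rule for the two projections.
  have hpair' : dirDeriv (fun r ↦ (X r, w r)) q u = (dirDeriv X q u, dirDeriv w q u) := by
    have h1 := dirDeriv_comp (f := Prod.fst) differentiableAt_fst hpair u
    have h2 := dirDeriv_comp (f := Prod.snd) differentiableAt_snd hpair u
    rw [fderiv_fst] at h1
    rw [fderiv_snd] at h2
    exact Prod.ext h1.symm h2.symm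
  have hf : HasFDerivAt (fun z : E × A ↦ T z.1 z.2) _ (X q, w q) :=
    (HasFDerivAt.comp (X q, w q) (g := T) (f := Prod.fst) hT.hasFDerivAt
      hasFDerivAt_fst).clm_apply hasFDerivAt_snd
  have h := dirDeriv_comp (f := fun z : E × A ↦ T z.1 z.2) (X := fun r ↦ (X r, w r)) (q := q)
    hf.differentiableAt hpair u
  rw [h, hf.fderiv, hpair']
  simp [add_comm]

/-- The chain rule for charts. -/
theorem dirDeriv_extChartAt {f : N → M} {q : N} (hq : f q ∈ (chartAt E x₀).source)
    (hf : MDifferentiableAt 𝓘(ℝ, F) 𝓘(ℝ, E) f q) (u : TangentSpace 𝓘(ℝ, F) q) :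
    dirDeriv (fun r ↦ extChartAt 𝓘(ℝ, E) x₀ (f r)) q u =
      chartDeriv x₀ (f q) (mfderiv 𝓘(ℝ, F) 𝓘(ℝ, E) f q u) := by
  have := mfderiv_comp q (mdifferentiableAt_extChartAt (I := 𝓘(ℝ, E)) hq) hf
  exact congrArg (fun T ↦ T u) this

theorem mdifferentiableAt_extChartAt_comp {f : N → M} {q : N} (hq : f q ∈ (chartAt E x₀).source)
    (hf : MDifferentiableAt 𝓘(ℝ, F) 𝓘(ℝ, E) f q) :
    MDifferentiableAt 𝓘(ℝ, F) 𝓘(ℝ, E) (fun r ↦ extChartAt 𝓘(ℝ, E) x₀ (f r)) q :=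
  (mdifferentiableAt_extChartAt (I := 𝓘(ℝ, E)) hq).comp q hf

theorem chartDeriv_coordChange {x₁ : M} (h₀ : x ∈ (chartAt E x₀).source)
    (h₁ : x ∈ (chartAt E x₁).source) (v : TangentSpace 𝓘(ℝ, E) x) :
    chartDeriv x₁ x v = fderiv ℝ (extChartAt 𝓘(ℝ, E) x₁ ∘ (extChartAt 𝓘(ℝ, E) x₀).symm)
      (extChartAt 𝓘(ℝ, E) x₀ x) (chartDeriv x₀ x v) := by
  have h := dirDeriv_comp (N := M) (F := E) (X := extChartAt 𝓘(ℝ, E) x₀) (q := x)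
    ((contDiffAt_coordChange h₀ h₁).differentiableAt (by simp))
    (mdifferentiableAt_extChartAt (I := 𝓘(ℝ, E)) h₀) v
  refine Eq.trans ?_ h
  refine dirDeriv_congr ?_ v
  filter_upwards [(chartAt E x₀).open_source.mem_nhds h₀] with z hz
  simp only [Function.comp_apply]
  rw [(extChartAt 𝓘(ℝ, E) x₀).left_inv (by rwa [extChartAt_source])]

end Charts

/-! ### The metric in a chart -/

section Metric

variable [IsManifold 𝓘(ℝ, E) ∞ M] (g : LorentzMetric E M) {x₀ x : M}

theorem chartMetric_chartDeriv (hx : x ∈ (chartAt E x₀).source) (u v : TangentSpace 𝓘(ℝ, E) x) :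
    g.chartMetric x₀ (extChartAt 𝓘(ℝ, E) x₀ x) (chartDeriv x₀ x u) (chartDeriv x₀ x v) =
      g.inner x u v := by
  rw [← extChartAt_source 𝓘(ℝ, E)] at hx
  -- Writing the point as an inverse chart image makes the tangent spaces agree on the nose and
  -- avoids transport between fibres.
  obtain ⟨y, hy, rfl⟩ : ∃ y ∈ (extChartAt 𝓘(ℝ, E) x₀).target, (extChartAt 𝓘(ℝ, E) x₀).symm y = x :=
    ⟨_, (extChartAt 𝓘(ℝ, E) x₀).map_source hx, (extChartAt 𝓘(ℝ, E) x₀).left_inv hx⟩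
  rw [(extChartAt 𝓘(ℝ, E) x₀).right_inv hy]
  change g.inner _ (chartSymmDeriv x₀ y (chartDeriv x₀ _ u))
    (chartSymmDeriv x₀ y (chartDeriv x₀ _ v)) = _
  rw [chartSymmDeriv_chartDeriv hy, chartSymmDeriv_chartDeriv hy]

theorem inner_comm (u v : TangentSpace 𝓘(ℝ, E) x) : g.inner x u v = g.inner x v u :=
  (g.lorentz x).symm u v

theorem chartMetric_comm (hx : x ∈ (chartAt E x₀).source) (a b : E) :
    g.chartMetric x₀ (extChartAt 𝓘(ℝ, E) x₀ x) a b =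
      g.chartMetric x₀ (extChartAt 𝓘(ℝ, E) x₀ x) b a := by
  obtain ⟨u, rfl⟩ := chartDeriv_surjective hx a
  obtain ⟨v, rfl⟩ := chartDeriv_surjective hx b
  rw [chartMetric_chartDeriv g hx, chartMetric_chartDeriv g hx, inner_comm]

theorem eventually_chartMetric_comm (hx : x ∈ (chartAt E x₀).source) :
    ∀ᶠ y in 𝓝 (extChartAt 𝓘(ℝ, E) x₀ x), ∀ a b,
      g.chartMetric x₀ y a b = g.chartMetric x₀ y b a := by
  filter_upwards [extChartAt_target_mem_nhds' (I := 𝓘(ℝ, E)) (x := x₀)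
    (y := extChartAt 𝓘(ℝ, E) x₀ x)
    ((extChartAt 𝓘(ℝ, E) x₀).map_source (by rwa [extChartAt_source]))] with y hy a b
  have h := g.chartMetric_comm (x₀ := x₀) (x := (extChartAt 𝓘(ℝ, E) x₀).symm y) (by
    rw [← extChartAt_source 𝓘(ℝ, E)]
    exact (extChartAt 𝓘(ℝ, E) x₀).map_target hy) a b
  rwa [(extChartAt 𝓘(ℝ, E) x₀).right_inv hy] at h

theorem isInvertible_chartMetric [FiniteDimensional ℝ E] (hx : x ∈ (chartAt E x₀).source) :
    (g.chartMetric x₀ (extChartAt 𝓘(ℝ, E) x₀ x)).IsInvertible := by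
  refine ContinuousLinearMap.isInvertible_of_injective_dual ?_
  rw [injective_iff_map_eq_zero]
  intro a ha
  obtain ⟨u, rfl⟩ := chartDeriv_surjective hx a
  have : u = 0 := (g.lorentz x).eq_zero_of_forall_eq_zero fun v ↦ by
    change g.inner x u v = 0
    rw [← chartMetric_chartDeriv g hx, ha]
    rfl
  rw [this, map_zero]

/-- In finite dimension it suffices to treat the entries. Each is `g` evaluated on two coordinate
fields, which are smooth because their chart components are constant. -/
theorem contDiffAt_chartMetric [FiniteDimensional ℝ E] (hx : x ∈ (chartAt E x₀).source) :
    ContDiffAt ℝ ∞ (g.chartMetric x₀) (extChartAt 𝓘(ℝ, E) x₀ x) := by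
  suffices h : ContDiffOn ℝ ∞ (g.chartMetric x₀) (extChartAt 𝓘(ℝ, E) x₀).target from
    h.contDiffAt (extChartAt_target_mem_nhds'
      ((extChartAt 𝓘(ℝ, E) x₀).map_source (by rwa [extChartAt_source])))
  refine contDiffOn_clm_apply.2 fun a ↦ contDiffOn_clm_apply.2 fun b ↦ ?_
  intro y hy
  refine ContDiffAt.contDiffWithinAt ?_
  rw [← contMDiffAt_iff_contDiffAt]
  have hsrc : (extChartAt 𝓘(ℝ, E) x₀).symm y ∈ (chartAt E x₀).source := by
    rw [← extChartAt_source 𝓘(ℝ, E)]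
    exact (extChartAt 𝓘(ℝ, E) x₀).map_target hy
  have hsymm : ContMDiffAt 𝓘(ℝ, E) 𝓘(ℝ, E) ∞ (extChartAt 𝓘(ℝ, E) x₀).symm y :=
    (contMDiffOn_extChartAt_symm x₀).contMDiffAt (extChartAt_target_mem_nhds' hy)
  have hvec : ∀ a : E, ContMDiffAt 𝓘(ℝ, E) 𝓘(ℝ, E).tangent ∞ (fun z ↦
      (⟨(extChartAt 𝓘(ℝ, E) x₀).symm z, chartSymmDeriv x₀ z a⟩ : TangentBundle 𝓘(ℝ, E) M)) y := by
    intro a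
    rw [contMDiffAt_tangentBundle_iff hsrc]
    refine ⟨hsymm, (contMDiffAt_const (c := a)).congr_of_eventuallyEq ?_⟩
    filter_upwards [extChartAt_target_mem_nhds' hy] with z hz
    exact chartDeriv_chartSymmDeriv hz a
  have hinner := g.contMDiff.contMDiffAt.comp y hsymm
  have h := ContMDiffAt.clm_bundle_apply₂ (F₁ := E) (F₂ := E) (F₃ := ℝ)
    (E₁ := TangentSpace 𝓘(ℝ, E)) (E₂ := TangentSpace 𝓘(ℝ, E)) (E₃ := fun _ : M ↦ ℝ)
    hinner (hvec a) (hvec b)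
  rw [contMDiffAt_totalSpace] at h
  exact h.2

end Metric

end LorentzMetric

end PhotonSurface

end

noncomputable section

namespace PhotonSurface

namespace LorentzMetric

set_option maxSynthPendingDepth 3

variable {E : Type*} [NormedAddCommGroup E] [NormedSpace ℝ E]
  {M : Type*} [TopologicalSpace M] [ChartedSpace E M]
  {F : Type*} [NormedAddCommGroup F] [NormedSpace ℝ F]
  {S : Type*} [TopologicalSpace S] [ChartedSpace F S]
  {K : Type*} [NormedAddCommGroup K] [NormedSpace ℝ K]
  {N : Type*} [TopologicalSpace N] [ChartedSpace K N]
  {i : S → M} {x₀ : M} {p₀ q : S}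

/-- The coordinate expression of `i` with respect to the charts around `x₀` and `p₀`. -/
def localRep (i : S → M) (x₀ : M) (p₀ : S) : F → E :=
  fun y ↦ extChartAt 𝓘(ℝ, E) x₀ (i ((extChartAt 𝓘(ℝ, F) p₀).symm y))

theorem localRep_extChartAt (hq : q ∈ (chartAt F p₀).source) :
    localRep (E := E) (F := F) i x₀ p₀ (extChartAt 𝓘(ℝ, F) p₀ q) =
      extChartAt 𝓘(ℝ, E) x₀ (i q) := by
  rw [localRep, (extChartAt 𝓘(ℝ, F) p₀).left_inv (by rwa [extChartAt_source])]

variable [IsManifold 𝓘(ℝ, E) ∞ M] (g : LorentzMetric E M)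

/-! ### The covariant derivative in an arbitrary chart -/

section Covariant

theorem covDerivAlong_congr {f : N → M} {W W' : ∀ q, TangentSpace 𝓘(ℝ, E) (f q)} {p : N}
    (h : ∀ᶠ q in 𝓝 p, W q = W' q) (u : TangentSpace 𝓘(ℝ, K) p) :
    g.covDerivAlong f W p u = g.covDerivAlong f W' p u := by
  have h' : (fun q ↦ chartDeriv (f p) (f q) (W q)) =ᶠ[𝓝 p]
      fun q ↦ chartDeriv (f p) (f q) (W' q) := h.mono fun q hq ↦ by simp only [hq]
  rw [covDerivAlong, covDerivAlong, dirDeriv_congr h', h.self_of_nhds]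

/-- The coordinate expression of the Levi-Civita derivative does not depend on the chart. -/
theorem chartDeriv_covDerivAlong [FiniteDimensional ℝ E] {f : N → M}
    {W : ∀ q, TangentSpace 𝓘(ℝ, E) (f q)} {p : N} (hx : f p ∈ (chartAt E x₀).source)
    (hf : MDifferentiableAt 𝓘(ℝ, K) 𝓘(ℝ, E) f p)
    (hW : MDifferentiableAt 𝓘(ℝ, K) 𝓘(ℝ, E) (fun q ↦ chartDeriv x₀ (f q) (W q)) p)
    (u : TangentSpace 𝓘(ℝ, K) p) :
    chartDeriv x₀ (f p) (g.covDerivAlong f W p u) =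
      dirDeriv (fun q ↦ chartDeriv x₀ (f q) (W q)) p u
        + christoffelOf (g.chartMetric x₀) (extChartAt 𝓘(ℝ, E) x₀ (f p))
          (dirDeriv (fun r ↦ extChartAt 𝓘(ℝ, E) x₀ (f r)) p u)
          (chartDeriv x₀ (f p) (W p)) := by
  -- The transition map to the chart around `f p`, in which `covDerivAlong` is defined.
  set θ : E → E := extChartAt 𝓘(ℝ, E) (f p) ∘ (extChartAt 𝓘(ℝ, E) x₀).symm with hθ
  have hx₁ : f p ∈ (chartAt E (f p)).source := mem_chart_source E (f p)
  have hθs : ContDiffAt ℝ ∞ θ (extChartAt 𝓘(ℝ, E) x₀ (f p)) := contDiffAt_coordChange hx hx₁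
  have hθx : θ (extChartAt 𝓘(ℝ, E) x₀ (f p)) = extChartAt 𝓘(ℝ, E) (f p) (f p) := by
    rw [hθ, Function.comp_apply, (extChartAt 𝓘(ℝ, E) x₀).left_inv (by rwa [extChartAt_source])]
  have hcd : ∀ v, chartDeriv (f p) (f p) v = fderiv ℝ θ (extChartAt 𝓘(ℝ, E) x₀ (f p))
      (chartDeriv x₀ (f p) v) := chartDeriv_coordChange hx hx₁
  have hchr := fun a b ↦ fderiv_christoffelOf (G := g.chartMetric x₀)
    (G' := g.chartMetric (f p)) hθs
    (by rw [hθx]; exact (g.contDiffAt_chartMetric hx₁).differentiableAt (by simp))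
    (by
      filter_upwards [extChartAt_target_mem_nhds' (I := 𝓘(ℝ, E)) (x := x₀)
          ((extChartAt 𝓘(ℝ, E) x₀).map_source (by rwa [extChartAt_source])),
        (continuousAt_extChartAt_symm' (I := 𝓘(ℝ, E)) (x := x₀) (x' := f p)
          (by rwa [extChartAt_source])).eventually_mem
          ((chartAt E (f p)).open_source.mem_nhds (by
            rwa [(extChartAt 𝓘(ℝ, E) x₀).left_inv (by rwa [extChartAt_source])]))] with y hy hy'
      intro a b
      have hz : (extChartAt 𝓘(ℝ, E) x₀).symm y ∈ (chartAt E x₀).source := by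
        rw [← extChartAt_source 𝓘(ℝ, E)]
        exact (extChartAt 𝓘(ℝ, E) x₀).map_target hy
      obtain ⟨u, rfl⟩ := chartDeriv_surjective hz a
      obtain ⟨v, rfl⟩ := chartDeriv_surjective hz b
      have h0 := g.chartMetric_chartDeriv hz u v
      have h1 := g.chartMetric_chartDeriv hy' u v
      rw [chartDeriv_coordChange hz hy', chartDeriv_coordChange hz hy',
        (extChartAt 𝓘(ℝ, E) x₀).right_inv hy] at h1
      rw [(extChartAt 𝓘(ℝ, E) x₀).right_inv hy] at h0
      exact h0.trans h1.symm)
    ((g.contDiffAt_chartMetric hx).differentiableAt (by simp))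
    (by rw [hθx]; exact g.eventually_chartMetric_comm hx₁)
    (g.isInvertible_chartMetric hx)
    (by rw [hθx]; exact g.isInvertible_chartMetric hx₁)
    (fun d ↦ by
      obtain ⟨v, rfl⟩ := chartDeriv_surjective hx₁ d
      exact ⟨_, (hcd v).symm⟩) a b
  have hev : ∀ᶠ q in 𝓝 p, f q ∈ (chartAt E x₀).source ∧ f q ∈ (chartAt E (f p)).source :=
    (hf.continuousAt.eventually_mem ((chartAt E x₀).open_source.mem_nhds hx)).and
      (hf.continuousAt.eventually_mem ((chartAt E (f p)).open_source.mem_nhds hx₁))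
  have hXd := mdifferentiableAt_extChartAt_comp hx hf
  -- The new components of `W` are `θ'` applied to the old ones. The `θ''` term produced by the
  -- product rule is the inhomogeneous term of the Christoffel transformation law `hchr`.
  have hWd : dirDeriv (fun q ↦ chartDeriv (f p) (f q) (W q)) p u =
      fderiv ℝ (fderiv ℝ θ) (extChartAt 𝓘(ℝ, E) x₀ (f p))
        (dirDeriv (fun r ↦ extChartAt 𝓘(ℝ, E) x₀ (f r)) p u) (chartDeriv x₀ (f p) (W p))
      + fderiv ℝ θ (extChartAt 𝓘(ℝ, E) x₀ (f p))
        (dirDeriv (fun q ↦ chartDeriv x₀ (f q) (W q)) p u) := by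
    rw [← dirDeriv_clm_apply (T := fderiv ℝ θ)
      (X := fun r ↦ extChartAt 𝓘(ℝ, E) x₀ (f r)) ((hθs.fderiv_right (m := ∞) (by
      simp)).differentiableAt (by simp)) hXd hW]
    refine dirDeriv_congr ?_ u
    filter_upwards [hev] with q hq
    exact chartDeriv_coordChange hq.1 hq.2 (W q)
  set R := dirDeriv (fun q ↦ chartDeriv x₀ (f q) (W q)) p u
        + christoffelOf (g.chartMetric x₀) (extChartAt 𝓘(ℝ, E) x₀ (f p))
          (dirDeriv (fun r ↦ extChartAt 𝓘(ℝ, E) x₀ (f r)) p u)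
          (chartDeriv x₀ (f p) (W p)) with hR
  obtain ⟨z, hz⟩ := chartDeriv_surjective hx R
  have hcov : g.covDerivAlong f W p u = z := by
    rw [covDerivAlong, ← (isInvertible_chartDeriv hx₁).inverse_apply_self z]
    congr 1
    rw [hcd z, hz, hR, map_add, hchr, hWd, hθx, dirDeriv_extChartAt hx hf, ← hcd, ← hcd]
    change _ + christoffelOf _ _ _ _ = _
    abel
  rw [hcov, hz]

end Covariant

/-! ### Immersions in charts -/

section Immersion

variable [IsManifold 𝓘(ℝ, F) ∞ S]

theorem contDiffAt_localRep (hi : ContMDiff 𝓘(ℝ, F) 𝓘(ℝ, E) ∞ i)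
    (hq : q ∈ (chartAt F p₀).source) (hiq : i q ∈ (chartAt E x₀).source) :
    ContDiffAt ℝ ∞ (localRep (E := E) (F := F) i x₀ p₀) (extChartAt 𝓘(ℝ, F) p₀ q) := by
  rw [← contMDiffAt_iff_contDiffAt]
  have hq' : q ∈ (extChartAt 𝓘(ℝ, F) p₀).source := by rwa [extChartAt_source]
  have hsymm : ContMDiffAt 𝓘(ℝ, F) 𝓘(ℝ, F) ∞ (extChartAt 𝓘(ℝ, F) p₀).symm
      (extChartAt 𝓘(ℝ, F) p₀ q) :=
    (contMDiffOn_extChartAt_symm p₀).contMDiffAt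
      (extChartAt_target_mem_nhds' ((extChartAt 𝓘(ℝ, F) p₀).map_source hq'))
  have hchart : ContMDiffAt 𝓘(ℝ, E) 𝓘(ℝ, E) ∞ (extChartAt 𝓘(ℝ, E) x₀) (i q) :=
    contMDiffAt_extChartAt' hiq
  refine ContMDiffAt.comp_of_eq (x := extChartAt 𝓘(ℝ, F) p₀ q) (y := i q)
    (f := fun y ↦ i ((extChartAt 𝓘(ℝ, F) p₀).symm y)) hchart
    (hi.contMDiffAt.comp _ hsymm) ?_
  rw [(extChartAt 𝓘(ℝ, F) p₀).left_inv hq']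

theorem chartDeriv_mfderiv (hi : ContMDiff 𝓘(ℝ, F) 𝓘(ℝ, E) ∞ i)
    (hq : q ∈ (chartAt F p₀).source) (hiq : i q ∈ (chartAt E x₀).source)
    (v : TangentSpace 𝓘(ℝ, F) q) :
    chartDeriv x₀ (i q) (mfderiv 𝓘(ℝ, F) 𝓘(ℝ, E) i q v) =
      fderiv ℝ (localRep (E := E) (F := F) i x₀ p₀) (extChartAt 𝓘(ℝ, F) p₀ q)
        (chartDeriv p₀ q v) := by
  have : IsManifold 𝓘(ℝ, F) 1 S := isManifold_one
  rw [← dirDeriv_extChartAt hiq (hi.mdifferentiable (by simp) q)]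
  refine Eq.trans ?_ (dirDeriv_comp (N := S) (F := F) (X := extChartAt 𝓘(ℝ, F) p₀) (q := q)
    ((contDiffAt_localRep hi hq hiq).differentiableAt (by simp))
    (mdifferentiableAt_extChartAt (I := 𝓘(ℝ, F)) hq) v)
  refine dirDeriv_congr ?_ v
  filter_upwards [(chartAt F p₀).open_source.mem_nhds hq] with z hz
  rw [localRep_extChartAt hz]

/-- The coordinate expression of the Levi-Civita derivative of a tangential vector field. -/
theorem chartDeriv_covDerivAlong_tangential [FiniteDimensional ℝ E]
    (hi : ContMDiff 𝓘(ℝ, F) 𝓘(ℝ, E) ∞ i) {τ : N → S}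
    {v : ∀ r, TangentSpace 𝓘(ℝ, F) (τ r)} {r : N} (hτ : MDifferentiableAt 𝓘(ℝ, K) 𝓘(ℝ, F) τ r)
    (hq : τ r ∈ (chartAt F p₀).source) (hiq : i (τ r) ∈ (chartAt E x₀).source)
    (hv : MDifferentiableAt 𝓘(ℝ, K) 𝓘(ℝ, F) (fun r ↦ chartDeriv p₀ (τ r) (v r)) r)
    (u : TangentSpace 𝓘(ℝ, K) r) :
    chartDeriv x₀ (i (τ r)) (g.covDerivAlong (fun r ↦ i (τ r))
        (fun r ↦ mfderiv 𝓘(ℝ, F) 𝓘(ℝ, E) i (τ r) (v r)) r u) =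
      secondForm (g.chartMetric x₀) (localRep i x₀ p₀) (extChartAt 𝓘(ℝ, F) p₀ (τ r))
        (dirDeriv (fun r ↦ extChartAt 𝓘(ℝ, F) p₀ (τ r)) r u) (chartDeriv p₀ (τ r) (v r))
      + fderiv ℝ (localRep (E := E) i x₀ p₀) (extChartAt 𝓘(ℝ, F) p₀ (τ r))
        (dirDeriv (fun r ↦ chartDeriv p₀ (τ r) (v r)) r u) := by
  have hf : MDifferentiableAt 𝓘(ℝ, K) 𝓘(ℝ, E) (fun r ↦ i (τ r)) r :=
    (hi.mdifferentiable (by simp) (τ r)).comp r hτ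
  have hι := contDiffAt_localRep hi hq hiq
  have hιd : DifferentiableAt ℝ (fderiv ℝ (localRep (E := E) (F := F) i x₀ p₀))
      (extChartAt 𝓘(ℝ, F) p₀ (τ r)) :=
    (hι.fderiv_right (m := ∞) (by simp)).differentiableAt (by simp)
  have hX := mdifferentiableAt_extChartAt_comp hq hτ
  have hev : ∀ᶠ s in 𝓝 r, τ s ∈ (chartAt F p₀).source ∧ i (τ s) ∈ (chartAt E x₀).source :=
    (hτ.continuousAt.eventually_mem ((chartAt F p₀).open_source.mem_nhds hq)).and
      (hf.continuousAt.eventually_mem ((chartAt E x₀).open_source.mem_nhds hiq))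
  have hWeq : (fun s ↦ chartDeriv x₀ (i (τ s)) (mfderiv 𝓘(ℝ, F) 𝓘(ℝ, E) i (τ s) (v s))) =ᶠ[𝓝 r]
      fun s ↦ fderiv ℝ (localRep (E := E) (F := F) i x₀ p₀) (extChartAt 𝓘(ℝ, F) p₀ (τ s))
        (chartDeriv p₀ (τ s) (v s)) :=
    hev.mono fun s hs ↦ chartDeriv_mfderiv hi hs.1 hs.2 (v s)
  have hXeq : (fun s ↦ extChartAt 𝓘(ℝ, E) x₀ (i (τ s))) =ᶠ[𝓝 r]
      fun s ↦ localRep (E := E) (F := F) i x₀ p₀ (extChartAt 𝓘(ℝ, F) p₀ (τ s)) :=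
    hev.mono fun s hs ↦ (localRep_extChartAt hs.1).symm
  have hWd : MDifferentiableAt 𝓘(ℝ, K) 𝓘(ℝ, E)
      (fun s ↦ chartDeriv x₀ (i (τ s)) (mfderiv 𝓘(ℝ, F) 𝓘(ℝ, E) i (τ s) (v s))) r := by
    refine MDifferentiableAt.congr_of_eventuallyEq ?_ hWeq
    exact MDifferentiableAt.clm_apply (hιd.mdifferentiableAt.comp r hX) hv
  -- Differentiating `ι'(τ) v` gives `ι''(τ', v) + ι' v'`; the first term and the Christoffel term
  -- form `secondForm`.
  rw [chartDeriv_covDerivAlong g (f := fun r ↦ i (τ r)) hiq hf hWd, dirDeriv_congr hWeq,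
    dirDeriv_congr hXeq,
    dirDeriv_clm_apply (X := fun r ↦ extChartAt 𝓘(ℝ, F) p₀ (τ r)) hιd hX hv,
    dirDeriv_comp (X := fun r ↦ extChartAt 𝓘(ℝ, F) p₀ (τ r)) (hι.differentiableAt (by simp)) hX,
    chartDeriv_mfderiv hi hq hiq, ← localRep_extChartAt (i := i) (x₀ := x₀) hq, secondForm]
  abel

end Immersion

end LorentzMetric

end PhotonSurface

end

noncomputable section

namespace PhotonSurface

namespace LorentzMetric

set_option maxSynthPendingDepth 3

variable {E : Type*} [NormedAddCommGroup E] [NormedSpace ℝ E]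
  {M : Type*} [TopologicalSpace M] [ChartedSpace E M]
  {F : Type*} [NormedAddCommGroup F] [NormedSpace ℝ F]
  {S : Type*} [TopologicalSpace S] [ChartedSpace F S]
  {i : S → M} {x₀ : M} {p₀ q : S}

/-- A tangent vector extends to a global smooth vector field. -/
theorem exists_contMDiff_vectorField [FiniteDimensional ℝ F] [T2Space S] [IsManifold 𝓘(ℝ, F) ∞ S]
    (v : TangentSpace 𝓘(ℝ, F) q) :
    ∃ w : ∀ p : S, TangentSpace 𝓘(ℝ, F) p, w q = v ∧
      ContMDiff 𝓘(ℝ, F) 𝓘(ℝ, F).tangent ∞ (fun p ↦ (⟨p, w p⟩ : TangentBundle 𝓘(ℝ, F) S)) := by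
  -- A local extension, cut off by a bump function supported where it is smooth.
  obtain ⟨s, hs, hsmooth⟩ := FiberBundle.exists_contMDiffOn_extend (k := ∞) 𝓘(ℝ, F) F v
  obtain ⟨t, hts, hto, hqt⟩ := mem_nhds_iff.1 hs
  obtain ⟨f, hf⟩ := (SmoothBumpFunction.nhds_basis_tsupport (I := 𝓘(ℝ, F)) q).mem_iff.1
    (hto.mem_nhds hqt)
  refine ⟨(f : S → ℝ) • FiberBundle.extend F v, ?_, ?_⟩
  · simp
  · exact ContMDiffOn.smul_section_of_tsupport f.contMDiff.contMDiffOn hto hf.2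
      (hsmooth.mono hts)

variable [IsManifold 𝓘(ℝ, E) ∞ M] (g : LorentzMetric E M)

/-! ### The induced metric and umbilicity in charts -/

section Induced

theorem inducedForm_apply (u v : TangentSpace 𝓘(ℝ, F) q) :
    g.inducedForm i q u v =
      g.inner (i q) (mfderiv 𝓘(ℝ, F) 𝓘(ℝ, E) i q u) (mfderiv 𝓘(ℝ, F) 𝓘(ℝ, E) i q v) := rfl

theorem IsTimelike.isNowhereSpacelike {g : LorentzMetric E M} (ht : g.IsTimelike (F := F) i) :
    g.IsNowhereSpacelike (F := F) i := by
  intro p hp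
  obtain ⟨v, hv, -⟩ := (ht p).signature
  refine lt_asymm hv (hp v ?_)
  rintro rfl
  simp at hv

/-- The induced form is nondegenerate, so the tangent space splits off. Hence `perpProj` is the true
projection here and not its default value `0`. -/
theorem isCompl_orthogonal_tangentRange [FiniteDimensional ℝ E] (ht : g.IsTimelike (F := F) i)
    (q : S) :
    IsCompl ((g.form (i q)).orthogonal (tangentRange (F := F) i q))
      (tangentRange (F := F) i q) := by
  have : FiniteDimensional ℝ (TangentSpace 𝓘(ℝ, E) (i q)) := inferInstanceAs (FiniteDimensional ℝ E)
  refine isCompl_orthogonal_of_restrict_injective (g.lorentz (i q)).symm ?_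
  rintro _ ⟨u, rfl⟩ hu
  have : u = 0 := (ht q).eq_zero_of_forall_eq_zero fun v ↦ hu _ ⟨v, rfl⟩
  rw [this, map_zero]

variable [IsManifold 𝓘(ℝ, F) ∞ S]

theorem pullbackMetric_chartDeriv (hi : ContMDiff 𝓘(ℝ, F) 𝓘(ℝ, E) ∞ i)
    (hq : q ∈ (chartAt F p₀).source) (hiq : i q ∈ (chartAt E x₀).source)
    (u v : TangentSpace 𝓘(ℝ, F) q) :
    pullbackMetric (g.chartMetric x₀) (localRep i x₀ p₀) (extChartAt 𝓘(ℝ, F) p₀ q)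
      (chartDeriv p₀ q u) (chartDeriv p₀ q v) = g.inducedForm i q u v := by
  rw [pullbackMetric_apply, ← chartDeriv_mfderiv hi hq hiq, ← chartDeriv_mfderiv hi hq hiq,
    localRep_extChartAt hq, chartMetric_chartDeriv g hiq, inducedForm_apply]

theorem isLorentzForm_pullbackMetric (hi : ContMDiff 𝓘(ℝ, F) 𝓘(ℝ, E) ∞ i)
    (ht : g.IsTimelike (F := F) i)
    (hq : q ∈ (chartAt F p₀).source) (hiq : i q ∈ (chartAt E x₀).source) :
    IsLorentzForm (pullbackMetric (g.chartMetric x₀) (localRep i x₀ p₀)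
      (extChartAt 𝓘(ℝ, F) p₀ q)).toLinearMap₁₂ := by
  have key := fun u v ↦ g.pullbackMetric_chartDeriv hi hq hiq u v
  refine ⟨fun a b ↦ ?_, ?_⟩
  · obtain ⟨u, rfl⟩ := chartDeriv_surjective hq a
    obtain ⟨v, rfl⟩ := chartDeriv_surjective hq b
    exact (key u v).trans (((ht q).symm u v).trans (key v u).symm)
  · obtain ⟨v, hv, hpos⟩ := (ht q).signature
    refine ⟨chartDeriv p₀ q v, (key v v).trans_lt hv, fun b hb hb0 ↦ ?_⟩
    obtain ⟨w, rfl⟩ := chartDeriv_surjective hq b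
    refine (hpos w ((key v w).symm.trans hb) ?_).trans_eq (key w w).symm
    rintro rfl
    exact hb0 (map_zero _)

theorem isInvertible_pullbackMetric [FiniteDimensional ℝ F]
    (hi : ContMDiff 𝓘(ℝ, F) 𝓘(ℝ, E) ∞ i) (ht : g.IsTimelike (F := F) i)
    (hq : q ∈ (chartAt F p₀).source) (hiq : i q ∈ (chartAt E x₀).source) :
    (pullbackMetric (g.chartMetric x₀) (localRep i x₀ p₀)
      (extChartAt 𝓘(ℝ, F) p₀ q)).IsInvertible := by
  refine ContinuousLinearMap.isInvertible_of_injective_dual ?_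
  rw [injective_iff_map_eq_zero]
  intro a ha
  refine (g.isLorentzForm_pullbackMetric hi ht hq hiq).eq_zero_of_forall_eq_zero fun b ↦ ?_
  exact congrArg (fun T ↦ T b) ha

theorem mem_tangentRange_iff (hi : ContMDiff 𝓘(ℝ, F) 𝓘(ℝ, E) ∞ i)
    (hq : q ∈ (chartAt F p₀).source) (hiq : i q ∈ (chartAt E x₀).source)
    (z : TangentSpace 𝓘(ℝ, E) (i q)) :
    z ∈ tangentRange (F := F) i q ↔ chartDeriv x₀ (i q) z ∈
      LinearMap.range (fderiv ℝ (localRep (E := E) (F := F) i x₀ p₀)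
        (extChartAt 𝓘(ℝ, F) p₀ q)).toLinearMap := by
  constructor
  · rintro ⟨u, rfl⟩
    exact ⟨chartDeriv p₀ q u, (chartDeriv_mfderiv hi hq hiq u).symm⟩
  · rintro ⟨a, ha⟩
    obtain ⟨u, rfl⟩ := chartDeriv_surjective hq a
    refine ⟨u, chartDeriv_injective hiq ?_⟩
    exact (chartDeriv_mfderiv hi hq hiq u).trans ha

theorem mem_orthogonal_tangentRange_iff (hi : ContMDiff 𝓘(ℝ, F) 𝓘(ℝ, E) ∞ i)
    (hq : q ∈ (chartAt F p₀).source) (hiq : i q ∈ (chartAt E x₀).source)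
    (z : TangentSpace 𝓘(ℝ, E) (i q)) :
    z ∈ (g.form (i q)).orthogonal (tangentRange (F := F) i q) ↔ ∀ a : F,
      g.chartMetric x₀ (localRep i x₀ p₀ (extChartAt 𝓘(ℝ, F) p₀ q)) (chartDeriv x₀ (i q) z)
        (fderiv ℝ (localRep (E := E) (F := F) i x₀ p₀) (extChartAt 𝓘(ℝ, F) p₀ q) a) = 0 := by
  have key : ∀ u : TangentSpace 𝓘(ℝ, F) q,
      g.chartMetric x₀ (localRep i x₀ p₀ (extChartAt 𝓘(ℝ, F) p₀ q)) (chartDeriv x₀ (i q) z)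
        (fderiv ℝ (localRep (E := E) (F := F) i x₀ p₀) (extChartAt 𝓘(ℝ, F) p₀ q)
          (chartDeriv p₀ q u)) = g.form (i q) (mfderiv 𝓘(ℝ, F) 𝓘(ℝ, E) i q u) z := by
    intro u
    rw [← chartDeriv_mfderiv hi hq hiq, localRep_extChartAt hq, chartMetric_chartDeriv g hiq,
      inner_comm]
    rfl
  rw [LinearMap.BilinForm.mem_orthogonal_iff]
  constructor
  · intro h a
    obtain ⟨u, rfl⟩ := chartDeriv_surjective hq a
    rw [key]
    exact h _ ⟨u, rfl⟩
  · rintro h _ ⟨u, rfl⟩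
    exact (key u).symm.trans (h _)

/-- Umbilicity at a point, expressed in charts. -/
theorem forall_secondFundamentalForm_eq_iff [FiniteDimensional ℝ E] [FiniteDimensional ℝ F]
    [T2Space S] (hi : ContMDiff 𝓘(ℝ, F) 𝓘(ℝ, E) ∞ i) (ht : g.IsTimelike (F := F) i)
    (hq : q ∈ (chartAt F p₀).source) (hiq : i q ∈ (chartAt E x₀).source)
    {z : TangentSpace 𝓘(ℝ, E) (i q)}
    (hz : z ∈ (g.form (i q)).orthogonal (tangentRange (F := F) i q)) :
    (∀ u w : ∀ p : S, TangentSpace 𝓘(ℝ, F) p,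
      ContMDiff 𝓘(ℝ, F) 𝓘(ℝ, F).tangent ∞ (fun p ↦ (⟨p, u p⟩ : TangentBundle 𝓘(ℝ, F) S)) →
      ContMDiff 𝓘(ℝ, F) 𝓘(ℝ, F).tangent ∞ (fun p ↦ (⟨p, w p⟩ : TangentBundle 𝓘(ℝ, F) S)) →
      g.secondFundamentalForm i u w q = g.inducedForm i q (u q) (w q) • z) ↔
    ∀ a b : F, secondForm (g.chartMetric x₀) (localRep i x₀ p₀) (extChartAt 𝓘(ℝ, F) p₀ q) a b
      - pullbackMetric (g.chartMetric x₀) (localRep i x₀ p₀) (extChartAt 𝓘(ℝ, F) p₀ q) a b •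
        chartDeriv x₀ (i q) z ∈ LinearMap.range (fderiv ℝ (localRep (E := E) (F := F) i x₀ p₀)
          (extChartAt 𝓘(ℝ, F) p₀ q)).toLinearMap := by
  have key : ∀ u w : ∀ p : S, TangentSpace 𝓘(ℝ, F) p,
      ContMDiff 𝓘(ℝ, F) 𝓘(ℝ, F).tangent ∞ (fun p ↦ (⟨p, w p⟩ : TangentBundle 𝓘(ℝ, F) S)) →
      (g.secondFundamentalForm i u w q = g.inducedForm i q (u q) (w q) • z ↔
        secondForm (g.chartMetric x₀) (localRep i x₀ p₀) (extChartAt 𝓘(ℝ, F) p₀ q)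
            (chartDeriv p₀ q (u q)) (chartDeriv p₀ q (w q))
          - pullbackMetric (g.chartMetric x₀) (localRep i x₀ p₀) (extChartAt 𝓘(ℝ, F) p₀ q)
            (chartDeriv p₀ q (u q)) (chartDeriv p₀ q (w q)) • chartDeriv x₀ (i q) z ∈
          LinearMap.range (fderiv ℝ (localRep (E := E) (F := F) i x₀ p₀)
            (extChartAt 𝓘(ℝ, F) p₀ q)).toLinearMap) := by
    intro u w hw
    have hw' := ((contMDiffAt_tangentBundle_iff hq).1 hw.contMDiffAt).2.mdifferentiableAt (by simp)
    have hcov := g.chartDeriv_covDerivAlong_tangential (τ := fun r : S ↦ r) (r := q) hi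
      mdifferentiableAt_id hq hiq hw' (u q)
    have hid : dirDeriv (fun r : S ↦ extChartAt 𝓘(ℝ, F) p₀ r) q (u q) = chartDeriv p₀ q (u q) := rfl
    rw [hid] at hcov
    rw [secondFundamentalForm, perpProj_eq_iff (g.isCompl_orthogonal_tangentRange ht q)
      (Submodule.smul_mem _ _ hz), mem_tangentRange_iff hi hq hiq, map_sub, map_smul, hcov,
      pullbackMetric_chartDeriv g hi hq hiq, add_sub_right_comm]
    -- The term with the derivative of `w` is tangential and drops out.
    exact Submodule.add_mem_iff_left _ ⟨_, rfl⟩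
  constructor
  · intro h a b
    obtain ⟨u₀, rfl⟩ := chartDeriv_surjective hq a
    obtain ⟨w₀, rfl⟩ := chartDeriv_surjective hq b
    -- Every pair of tangent vectors at `q` consists of values of global smooth fields, so the
    -- condition on fields gives the pointwise one.
    obtain ⟨u, rfl, hu⟩ := exists_contMDiff_vectorField u₀
    obtain ⟨w, rfl, hw⟩ := exists_contMDiff_vectorField w₀
    exact (key u w hw).1 (h u w hu hw)
  · intro h u w _ hw
    exact (key u w hw).2 (h _ _)

end Induced

/-! ### Acceleration of curves in the submanifold -/

/-- The unit tangent vector at a point of the real line. -/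
def unitTangent (r : ℝ) : TangentSpace 𝓘(ℝ, ℝ) r := (1 : ℝ)

theorem dirDeriv_unitTangent (h : ℝ → E) (t : ℝ) : dirDeriv h t (unitTangent t) = deriv h t := by
  rw [dirDeriv, mfderiv_eq_fderiv, ← fderiv_apply_one_eq_deriv]
  rfl

/-- The acceleration of a curve in the submanifold, in charts. -/
theorem chartDeriv_acceleration [FiniteDimensional ℝ E] [IsManifold 𝓘(ℝ, F) ∞ S]
    (hi : ContMDiff 𝓘(ℝ, F) 𝓘(ℝ, E) ∞ i)
    {σ : ℝ → S} {s : Set ℝ} (hs : IsOpen s) (hσ : ContMDiffOn 𝓘(ℝ, ℝ) 𝓘(ℝ, F) ∞ σ s) {t : ℝ}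
    (hts : t ∈ s) (hq : σ t ∈ (chartAt F p₀).source) (hiq : i (σ t) ∈ (chartAt E x₀).source) :
    chartDeriv x₀ (i (σ t)) (g.covDerivAlong (F := ℝ) (i ∘ σ)
        (fun r ↦ mfderiv 𝓘(ℝ, ℝ) 𝓘(ℝ, E) (i ∘ σ) r (unitTangent r)) t (unitTangent t)) =
      secondForm (g.chartMetric x₀) (localRep i x₀ p₀) (extChartAt 𝓘(ℝ, F) p₀ (σ t))
        (chartDeriv p₀ (σ t) (mfderiv 𝓘(ℝ, ℝ) 𝓘(ℝ, F) σ t (unitTangent t)))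
        (chartDeriv p₀ (σ t) (mfderiv 𝓘(ℝ, ℝ) 𝓘(ℝ, F) σ t (unitTangent t)))
      + fderiv ℝ (localRep (E := E) i x₀ p₀) (extChartAt 𝓘(ℝ, F) p₀ (σ t))
        (deriv (deriv fun r ↦ extChartAt 𝓘(ℝ, F) p₀ (σ r)) t) := by
  have hσd : ∀ r ∈ s, MDifferentiableAt 𝓘(ℝ, ℝ) 𝓘(ℝ, F) σ r := fun r hr ↦
    (hσ.contMDiffAt (hs.mem_nhds hr)).mdifferentiableAt (by simp)
  have hW : ∀ᶠ r in 𝓝 t, mfderiv 𝓘(ℝ, ℝ) 𝓘(ℝ, E) (i ∘ σ) r (unitTangent r) =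
      mfderiv 𝓘(ℝ, F) 𝓘(ℝ, E) i (σ r) (mfderiv 𝓘(ℝ, ℝ) 𝓘(ℝ, F) σ r (unitTangent r)) := by
    filter_upwards [hs.mem_nhds hts] with r hr
    rw [mfderiv_comp r (hi.mdifferentiable (by simp) (σ r)) (hσd r hr)]
    rfl
  have hev : ∀ᶠ r in 𝓝 t, r ∈ s ∧ σ r ∈ (chartAt F p₀).source :=
    (hs.eventually_mem hts).and ((hσd t hts).continuousAt.eventually_mem
      ((chartAt F p₀).open_source.mem_nhds hq))
  have hv : (fun r ↦ chartDeriv p₀ (σ r) (mfderiv 𝓘(ℝ, ℝ) 𝓘(ℝ, F) σ r (unitTangent r))) =ᶠ[𝓝 t]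
      deriv fun r ↦ extChartAt 𝓘(ℝ, F) p₀ (σ r) := by
    filter_upwards [hev] with r hr
    rw [← dirDeriv_extChartAt hr.2 (hσd r hr.1), dirDeriv_unitTangent]
  have hc : ContDiffAt ℝ ∞ (fun r ↦ extChartAt 𝓘(ℝ, F) p₀ (σ r)) t := by
    rw [← contMDiffAt_iff_contDiffAt]
    exact (contMDiffAt_extChartAt' (I := 𝓘(ℝ, F)) hq).comp t (hσ.contMDiffAt (hs.mem_nhds hts))
  have hcd : DifferentiableAt ℝ (deriv fun r ↦ extChartAt 𝓘(ℝ, F) p₀ (σ r)) t :=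
    ((hc.fderiv_right (m := ∞) (by simp)).differentiableAt (by simp)).clm_apply
      (differentiableAt_const (1 : ℝ))
  have hvd : MDifferentiableAt 𝓘(ℝ, ℝ) 𝓘(ℝ, F)
      (fun r ↦ chartDeriv p₀ (σ r) (mfderiv 𝓘(ℝ, ℝ) 𝓘(ℝ, F) σ r (unitTangent r))) t :=
    hcd.mdifferentiableAt.congr_of_eventuallyEq hv
  have h := g.chartDeriv_covDerivAlong_tangential (τ := σ) (r := t) hi (hσd t hts) hq hiq hvd
    (unitTangent t)
  rw [dirDeriv_extChartAt hq (hσd t hts), dirDeriv_congr hv, dirDeriv_unitTangent] at h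
  rw [covDerivAlong_congr g hW]
  exact h

end LorentzMetric

end PhotonSurface

end

noncomputable section

namespace PhotonSurface

namespace LorentzMetric

set_option maxSynthPendingDepth 3

variable {E : Type*} [NormedAddCommGroup E] [NormedSpace ℝ E] [FiniteDimensional ℝ E]
  {M : Type*} [TopologicalSpace M] [ChartedSpace E M] [IsManifold 𝓘(ℝ, E) ∞ M]
  {F : Type*} [NormedAddCommGroup F] [NormedSpace ℝ F]
  {S : Type*} [TopologicalSpace S] [ChartedSpace F S] [IsManifold 𝓘(ℝ, F) ∞ S]
  {i : S → M} {x₀ : M} {p₀ q : S}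

/-! ### Photon surfaces are totally umbilic -/

/-- The acceleration of the null geodesic vanishes, so `secondForm w w` is minus the `ι'`-image of
the coordinate acceleration. -/
theorem IsPhotonSurface.secondForm_mem_range {g : LorentzMetric E M}
    (hi : ContMDiff 𝓘(ℝ, F) 𝓘(ℝ, E) ∞ i) (hph : g.IsPhotonSurface (F := F) i)
    (hq : q ∈ (chartAt F p₀).source) (hiq : i q ∈ (chartAt E x₀).source) {w : F} (hw : w ≠ 0)
    (hnull : pullbackMetric (g.chartMetric x₀) (localRep i x₀ p₀) (extChartAt 𝓘(ℝ, F) p₀ q)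
      w w = 0) :
    secondForm (g.chartMetric x₀) (localRep i x₀ p₀) (extChartAt 𝓘(ℝ, F) p₀ q) w w ∈
      LinearMap.range (fderiv ℝ (localRep (E := E) (F := F) i x₀ p₀)
        (extChartAt 𝓘(ℝ, F) p₀ q)).toLinearMap := by
  obtain ⟨u, rfl⟩ := chartDeriv_surjective hq w
  rw [pullbackMetric_chartDeriv g hi hq hiq] at hnull
  obtain ⟨ε, hε, σ, hσ, heq, hgeo⟩ := hph.2 q u (by rintro rfl; exact hw (map_zero _)) hnull
  -- Stated on the tangent bundle so that the initial condition, an equality of bundle points, can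
  -- be rewritten directly.
  let Q : TangentBundle 𝓘(ℝ, F) S → Prop := fun z ↦
    z.1 ∈ (chartAt F p₀).source → i z.1 ∈ (chartAt E x₀).source →
      secondForm (g.chartMetric x₀) (localRep i x₀ p₀) (extChartAt 𝓘(ℝ, F) p₀ z.1)
        (chartDeriv p₀ z.1 z.2) (chartDeriv p₀ z.1 z.2) ∈
      LinearMap.range (fderiv ℝ (localRep (E := E) (F := F) i x₀ p₀)
        (extChartAt 𝓘(ℝ, F) p₀ z.1)).toLinearMap
  suffices hQ : Q ⟨q, u⟩ from hQ hq hiq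
  rw [← heq]
  intro hq' hiq'
  have h0 : (0 : ℝ) ∈ Set.Ioo (-ε) ε := ⟨by linarith, hε⟩
  have hacc := g.chartDeriv_acceleration hi isOpen_Ioo hσ h0 hq' hiq'
  have hzero : g.covDerivAlong (F := ℝ) (i ∘ σ)
      (fun r ↦ mfderiv 𝓘(ℝ, ℝ) 𝓘(ℝ, E) (i ∘ σ) r (unitTangent r)) 0 (unitTangent 0) = 0 :=
    hgeo.2 0 h0
  rw [hzero, map_zero] at hacc
  refine ⟨-deriv (deriv fun r ↦ extChartAt 𝓘(ℝ, F) p₀ (σ r)) 0, ?_⟩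
  rw [map_neg]
  exact (eq_neg_of_add_eq_zero_left hacc.symm).symm

/-- On a photon surface, the mean curvature vector exists at each point. -/
theorem IsPhotonSurface.exists_normal [T2Space S] {g : LorentzMetric E M}
    (hF : Module.finrank ℝ F = 2)
    (hi : ContMDiff 𝓘(ℝ, F) 𝓘(ℝ, E) ∞ i) (ht : g.IsTimelike (F := F) i)
    (hph : g.IsPhotonSurface (F := F) i) (q : S) :
    ∃ z ∈ (g.form (i q)).orthogonal (tangentRange (F := F) i q),
      ∀ u w : ∀ p : S, TangentSpace 𝓘(ℝ, F) p,
      ContMDiff 𝓘(ℝ, F) 𝓘(ℝ, F).tangent ∞ (fun p ↦ (⟨p, u p⟩ : TangentBundle 𝓘(ℝ, F) S)) →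
      ContMDiff 𝓘(ℝ, F) 𝓘(ℝ, F).tangent ∞ (fun p ↦ (⟨p, w p⟩ : TangentBundle 𝓘(ℝ, F) S)) →
      g.secondFundamentalForm i u w q = g.inducedForm i q (u q) (w q) • z := by
  have : FiniteDimensional ℝ F := FiniteDimensional.of_finrank_pos (by omega)
  have hq : q ∈ (chartAt F q).source := mem_chart_source F q
  have hiq : i q ∈ (chartAt E (i q)).source := mem_chart_source E (i q)
  set G := g.chartMetric (i q) with hG
  set ι : F → E := localRep (F := F) i (i q) q with hι
  set y := extChartAt 𝓘(ℝ, F) q q with hy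
  have hιy : ι y = extChartAt 𝓘(ℝ, E) (i q) (i q) := localRep_extChartAt hq
  have hιs : ContDiffAt ℝ ∞ ι y := contDiffAt_localRep hi hq hiq
  have hpinv := g.isInvertible_pullbackMetric hi ht hq hiq
  obtain ⟨v, hv, hvR⟩ := (g.isLorentzForm_pullbackMetric hi ht hq hiq).exists_smul_sub_smul_mem hF
    (B := secondFormBilin G ι y)
    (fun a b ↦ secondForm_comm hιs
      (by rw [hιy]; exact (g.contDiffAt_chartMetric hiq).differentiableAt (by simp))
      (by rw [hιy]; exact g.eventually_chartMetric_comm hiq) a b)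
    (R := LinearMap.range (fderiv ℝ ι y).toLinearMap)
    (fun w hw hnull ↦ hph.secondForm_mem_range hi hq hiq hw hnull)
  replace hv : pullbackMetric G ι y v v < 0 := hv
  replace hvR : ∀ a b, pullbackMetric G ι y v v • secondForm G ι y a b
      - pullbackMetric G ι y a b • secondForm G ι y v v ∈
      LinearMap.range (fderiv ℝ ι y).toLinearMap := hvR
  set B := secondForm G ι y v v with hB
  set c := pullbackMetric G ι y v v with hc
  -- The vector with coordinates `Π(v, v) / g(v, v)`: the normal part of `B`, divided by `c`, which
  -- is nonzero because `v` is timelike.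
  obtain ⟨z, hz⟩ := chartDeriv_surjective hiq
    (c⁻¹ • (B - fderiv ℝ ι y (tangentCoord G ι y B)))
  have hznormal : z ∈ (g.form (i q)).orthogonal (tangentRange (F := F) i q) := by
    rw [mem_orthogonal_tangentRange_iff g hi hq hiq, hz]
    intro a
    rw [map_smul, map_sub, smul_apply, sub_apply]
    have := apply_fderiv_tangentCoord hpinv B a
    change c⁻¹ • (G (ι y) B (fderiv ℝ ι y a) -
      G (ι y) (fderiv ℝ ι y (tangentCoord G ι y B)) (fderiv ℝ ι y a)) = 0
    rw [this, sub_self, smul_zero]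
  refine ⟨z, hznormal, (g.forall_secondFundamentalForm_eq_iff hi ht hq hiq hznormal).2 ?_⟩
  intro a b
  rw [hz]
  have h := Submodule.add_mem _ (Submodule.smul_mem _ c⁻¹ (hvR a b))
    (Submodule.smul_mem _ (c⁻¹ * pullbackMetric G ι y a b)
      (⟨tangentCoord G ι y B, rfl⟩ : fderiv ℝ ι y (tangentCoord G ι y B) ∈
        LinearMap.range (fderiv ℝ ι y).toLinearMap))
  convert h using 1
  have hc0 : c ≠ 0 := hv.ne
  simp only [smul_sub, smul_smul, inv_mul_cancel₀ hc0, one_smul]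
  change secondForm G ι y a b - _ = _
  module

/-- The normal vectors are chosen pointwise, so only smoothness remains. A coordinate vector `v`
timelike at `p₀` stays timelike nearby, and umbilicity on `(v, v)` forces `Z` to equal the smooth
local formula `f`. -/
theorem IsPhotonSurface.isTotallyUmbilic [T2Space S] {g : LorentzMetric E M}
    (hF : Module.finrank ℝ F = 2)
    (hi : ContMDiff 𝓘(ℝ, F) 𝓘(ℝ, E) ∞ i) (ht : g.IsTimelike (F := F) i)
    (hph : g.IsPhotonSurface (F := F) i) : g.IsTotallyUmbilic (F := F) i := by
  have : FiniteDimensional ℝ F := FiniteDimensional.of_finrank_pos (by omega)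
  choose Z hZ hsff using hph.exists_normal hF hi ht
  refine ⟨Z, fun p₀ ↦ ?_, hZ, fun u w hu hw p ↦ hsff p u w hu hw⟩
  have hp₀ : p₀ ∈ (chartAt F p₀).source := mem_chart_source F p₀
  have hip₀ : i p₀ ∈ (chartAt E (i p₀)).source := mem_chart_source E (i p₀)
  rw [contMDiffAt_tangentBundle_iff hip₀]
  refine ⟨hi.contMDiffAt, ?_⟩
  set G := g.chartMetric (i p₀) with hG
  set ι : F → E := localRep (F := F) i (i p₀) p₀ with hι
  set y₀ := extChartAt 𝓘(ℝ, F) p₀ p₀ with hy₀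
  have hιy : ι y₀ = extChartAt 𝓘(ℝ, E) (i p₀) (i p₀) := localRep_extChartAt hp₀
  have hιs : ContDiffAt ℝ ∞ ι y₀ := contDiffAt_localRep hi hp₀ hip₀
  have hGs : ContDiffAt ℝ ∞ G (ι y₀) := by rw [hιy]; exact g.contDiffAt_chartMetric hip₀
  have hGi : (G (ι y₀)).IsInvertible := by rw [hιy]; exact g.isInvertible_chartMetric hip₀
  obtain ⟨v, hv, -⟩ := (g.isLorentzForm_pullbackMetric hi ht hp₀ hip₀).signature
  replace hv : pullbackMetric G ι y₀ v v < 0 := hv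
  let f : F → E := fun y ↦ (pullbackMetric G ι y v v)⁻¹ • (secondForm G ι y v v
    - fderiv ℝ ι y (tangentCoord G ι y (secondForm G ι y v v)))
  have hps : ContDiffAt ℝ ∞ (fun y ↦ pullbackMetric G ι y v v) y₀ :=
    ((contDiffAt_pullbackMetric hιs hGs).clm_apply contDiffAt_const).clm_apply contDiffAt_const
  have hf : ContDiffAt ℝ ∞ f y₀ := by
    have hB : ContDiffAt ℝ ∞ (fun y ↦ secondForm G ι y v v) y₀ :=
      (contDiffAt_secondForm hιs hGs hGi v v).comp y₀
        (contDiffAt_id.prodMk (contDiffAt_const.prodMk contDiffAt_const))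
    have hT : ContDiffAt ℝ ∞ (fun y ↦ tangentCoord G ι y (secondForm G ι y v v)) y₀ :=
      ContDiffAt.comp y₀ (g := fun z : F × E ↦ tangentCoord G ι z.1 z.2)
        (f := fun y ↦ (y, secondForm G ι y v v)) (contDiffAt_tangentCoord hιs hGs
          (g.isInvertible_pullbackMetric hi ht hp₀ hip₀) _) (contDiffAt_id.prodMk hB)
    exact (hps.inv hv.ne).smul (hB.sub ((hιs.fderiv_right (m := ∞) (by simp)).clm_apply hT))
  have hchart : ContMDiffAt 𝓘(ℝ, F) 𝓘(ℝ, F) ∞ (extChartAt 𝓘(ℝ, F) p₀) p₀ :=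
    contMDiffAt_extChartAt
  have hfs : ContMDiffAt 𝓘(ℝ, F) 𝓘(ℝ, E) ∞ (fun q ↦ f (extChartAt 𝓘(ℝ, F) p₀ q)) p₀ :=
    hf.contMDiffAt.comp p₀ hchart
  refine hfs.congr_of_eventuallyEq ?_
  filter_upwards [(chartAt F p₀).open_source.mem_nhds hp₀,
    hi.continuous.continuousAt.eventually_mem ((chartAt E (i p₀)).open_source.mem_nhds hip₀),
    hchart.continuousAt.eventually (hps.continuousAt.eventually_lt continuousAt_const hv)]
    with q hq hiq hvq
  set y := extChartAt 𝓘(ℝ, F) p₀ q with hy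
  have hn := (mem_orthogonal_tangentRange_iff g hi hq hiq (Z q)).1 (hZ q)
  -- Since `Z q` is normal, `c` must be the tangential part of `secondForm v v`; solving for `Z q`
  -- gives `f`.
  obtain ⟨c, hc⟩ := (g.forall_secondFundamentalForm_eq_iff hi ht hq hiq (hZ q)).1 (hsff q) v v
  replace hc : fderiv ℝ ι y c = secondForm G ι y v v - pullbackMetric G ι y v v •
    chartDeriv (i p₀) (i q) (Z q) := hc
  have htan : tangentCoord G ι y (secondForm G ι y v v) = c := by
    refine tangentCoord_eq (g.isInvertible_pullbackMetric hi ht hq hiq) fun a ↦ ?_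
    have hna : G (ι y) (chartDeriv (i p₀) (i q) (Z q)) (fderiv ℝ ι y a) = 0 := hn a
    rw [hc, map_sub, map_smul, sub_apply, smul_apply, hna, smul_zero, sub_zero]
  change chartDeriv (i p₀) (i q) (Z q) = (pullbackMetric G ι y v v)⁻¹ • (secondForm G ι y v v
    - fderiv ℝ ι y (tangentCoord G ι y (secondForm G ι y v v)))
  rw [htan, hc, sub_sub_cancel, inv_smul_smul₀ hvq.ne]

/-! ### Totally umbilic surfaces are photon surfaces -/

theorem IsTotallyUmbilic.isPhotonSurface [FiniteDimensional ℝ F] [T2Space S]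
    {g : LorentzMetric E M} (hi : ContMDiff 𝓘(ℝ, F) 𝓘(ℝ, E) ∞ i) (ht : g.IsTimelike (F := F) i)
    (hu : g.IsTotallyUmbilic (F := F) i) : g.IsPhotonSurface (F := F) i := by
  refine ⟨ht.isNowhereSpacelike, fun p₀ w _ hw ↦ ?_⟩
  obtain ⟨Z, -, hZ, hsff⟩ := hu
  have hp₀ : p₀ ∈ (chartAt F p₀).source := mem_chart_source F p₀
  have hip₀ : i p₀ ∈ (chartAt E (i p₀)).source := mem_chart_source E (i p₀)
  set G := g.chartMetric (i p₀) with hG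
  set ι : F → E := localRep (F := F) i (i p₀) p₀ with hι
  set ψ := extChartAt 𝓘(ℝ, F) p₀ with hψ
  -- The coordinate domain on which both charts are valid.
  let U : Set F := ψ.target ∩ (fun y ↦ i (ψ.symm y)) ⁻¹' (chartAt E (i p₀)).source
  have hU : IsOpen U :=
    (hi.continuous.comp_continuousOn (continuousOn_extChartAt_symm p₀)).isOpen_inter_preimage
      (isOpen_extChartAt_target p₀) (chartAt E (i p₀)).open_source
  have hUq : ∀ y ∈ U, ψ.symm y ∈ (chartAt F p₀).source ∧
      i (ψ.symm y) ∈ (chartAt E (i p₀)).source ∧ ψ (ψ.symm y) = y := fun y hy ↦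
    ⟨by rw [← extChartAt_source 𝓘(ℝ, F)]; exact ψ.map_target hy.1, hy.2, ψ.right_inv hy.1⟩
  have hιy : ∀ y ∈ U, ι y = extChartAt 𝓘(ℝ, E) (i p₀) (i (ψ.symm y)) := fun y _ ↦ rfl
  have hyU : ψ p₀ ∈ U := ⟨mem_extChartAt_target p₀, by
    rw [Set.mem_preimage, ψ.left_inv (mem_extChartAt_source p₀)]
    exact hip₀⟩
  have hsymm : ∀ y ∈ U, ContMDiffAt 𝓘(ℝ, F) 𝓘(ℝ, F) ∞ ψ.symm y := fun y hy ↦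
    (contMDiffOn_extChartAt_symm p₀).contMDiffAt (extChartAt_target_mem_nhds' hy.1)
  obtain ⟨ε, hε, s, v, hs0, hv0, hss, hs⟩ := exists_induced_geodesic (G := G) (ι := ι) hU
    (fun y hy ↦ by
      obtain ⟨h1, h2, h3⟩ := hUq y hy
      have := contDiffAt_localRep hi h1 h2
      rwa [h3] at this)
    (fun y hy ↦ by
      rw [hιy y hy]
      exact g.contDiffAt_chartMetric (hUq y hy).2.1)
    (fun y hy ↦ by
      rw [hιy y hy]
      exact g.chartMetric_comm (hUq y hy).2.1)
    (fun y hy ↦ by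
      rw [hιy y hy]
      exact g.isInvertible_chartMetric (hUq y hy).2.1)
    (fun y hy ↦ by
      obtain ⟨h1, h2, h3⟩ := hUq y hy
      have := g.isInvertible_pullbackMetric hi ht h1 h2
      rwa [h3] at this)
    hyU (chartDeriv p₀ p₀ w)
  have h0 : (0 : ℝ) ∈ Set.Ioo (-ε) ε := ⟨by linarith, hε⟩
  let σ : ℝ → S := fun t ↦ ψ.symm (s t)
  have hσ : ContMDiffOn 𝓘(ℝ, ℝ) 𝓘(ℝ, F) ∞ σ (Set.Ioo (-ε) ε) := fun t ht' ↦
    ((hsymm _ (hs t ht').1).comp t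
      (hss.contDiffAt (isOpen_Ioo.mem_nhds ht')).contMDiffAt).contMDiffWithinAt
  have hσd : ∀ t ∈ Set.Ioo (-ε) ε, MDifferentiableAt 𝓘(ℝ, ℝ) 𝓘(ℝ, F) σ t := fun t ht' ↦
    (hσ.contMDiffAt (isOpen_Ioo.mem_nhds ht')).mdifferentiableAt (by simp)
  have hψσ : ∀ t ∈ Set.Ioo (-ε) ε, ψ (σ t) = s t := fun t ht' ↦ (hUq _ (hs t ht').1).2.2
  have hψσ' : ∀ t ∈ Set.Ioo (-ε) ε, (fun r ↦ ψ (σ r)) =ᶠ[𝓝 t] s := fun t ht' ↦ by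
    filter_upwards [isOpen_Ioo.mem_nhds ht'] with r hr using hψσ r hr
  have hderiv : ∀ t ∈ Set.Ioo (-ε) ε, deriv (fun r ↦ ψ (σ r)) t = v t := fun t ht' ↦ by
    rw [(hψσ' t ht').deriv_eq, (hs t ht').2.1.deriv]
  have hvel : ∀ t ∈ Set.Ioo (-ε) ε,
      chartDeriv p₀ (σ t) (mfderiv 𝓘(ℝ, ℝ) 𝓘(ℝ, F) σ t (unitTangent t)) = v t := fun t ht' ↦ by
    rw [← dirDeriv_extChartAt (f := σ) (hUq _ (hs t ht').1).1 (hσd t ht'), dirDeriv_unitTangent]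
    exact hderiv t ht'
  refine ⟨ε, hε, σ, hσ, ?_, hi.comp_contMDiffOn hσ, fun t ht' ↦ ?_⟩
  · have hσ0 : σ 0 = p₀ := by
      change ψ.symm (s 0) = p₀
      rw [hs0, ψ.left_inv (mem_extChartAt_source p₀)]
    have key : ∀ (q : S) (a : TangentSpace 𝓘(ℝ, F) q), q = p₀ →
        chartDeriv p₀ q a = chartDeriv p₀ p₀ w →
        (⟨q, a⟩ : TangentBundle 𝓘(ℝ, F) S) = ⟨p₀, w⟩ := by
      rintro q a rfl h
      rw [chartDeriv_injective hp₀ h]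
    exact key _ _ hσ0 ((hvel 0 h0).trans hv0)
  · obtain ⟨hsU, -, hvd, hconst⟩ := hs t ht'
    obtain ⟨h1, h2, h3⟩ := hUq _ hsU
    -- The velocity is null at time `0`, hence at all times.
    rw [pullbackMetric_chartDeriv g hi hp₀ hip₀, hw] at hconst
    have hacc := g.chartDeriv_acceleration hi isOpen_Ioo hσ ht' h1 h2
    have hdd : deriv (deriv fun r ↦ ψ (σ r)) t =
        -tangentCoord G ι (s t) (secondForm G ι (s t) (v t) (v t)) := by
      have : (deriv fun r ↦ ψ (σ r)) =ᶠ[𝓝 t] v := by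
        filter_upwards [isOpen_Ioo.mem_nhds ht'] with r hr using hderiv r hr
      rw [this.deriv_eq, hvd.deriv]
    rw [hvel t ht', hdd, hψσ t ht'] at hacc
    -- On a null velocity the `Z` term disappears, so `secondForm` is wholly tangential and the
    -- coordinate acceleration cancels all of it.
    obtain ⟨c, hc⟩ := (g.forall_secondFundamentalForm_eq_iff hi ht h1 h2 (hZ _)).1
      (fun u w hu hw ↦ hsff u w hu hw _) (v t) (v t)
    have hpinv := g.isInvertible_pullbackMetric hi ht h1 h2
    rw [h3] at hc hpinv
    replace hc : fderiv ℝ ι (s t) c = secondForm G ι (s t) (v t) (v t) := by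
      rw [hconst, zero_smul, sub_zero] at hc
      exact hc
    have htan : tangentCoord G ι (s t) (secondForm G ι (s t) (v t) (v t)) = c :=
      tangentCoord_eq hpinv fun a ↦ by rw [hc]
    refine chartDeriv_injective h2 (hacc.trans ?_)
    rw [htan, map_neg, map_zero]
    change secondForm G ι (s t) (v t) (v t) + -fderiv ℝ ι (s t) c = 0
    rw [hc, add_neg_cancel]

end LorentzMetric

end PhotonSurface

end

theorem proposition3
    {E : Type*} [NormedAddCommGroup E] [NormedSpace ℝ E] [FiniteDimensional ℝ E]
    {M : Type*} [TopologicalSpace M] [T2Space M] [ChartedSpace E M] [IsManifold 𝓘(ℝ, E) ∞ M]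
    {F : Type*} [NormedAddCommGroup F] [NormedSpace ℝ F]
    {S : Type*} [TopologicalSpace S] [T2Space S] [ChartedSpace F S] [IsManifold 𝓘(ℝ, F) ∞ S]
    (hF : Module.finrank ℝ F = 2)
    (g : PhotonSurface.LorentzMetric E M)
    (i : S → M) (hi : ContMDiff 𝓘(ℝ, F) 𝓘(ℝ, E) ∞ i)
    (hi' : ∀ p, Function.Injective (mfderiv 𝓘(ℝ, F) 𝓘(ℝ, E) i p))
    (ht : g.IsTimelike (F := F) i) :
    g.IsPhotonSurface (F := F) i ↔ g.IsTotallyUmbilic (F := F) i := by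
  have : FiniteDimensional ℝ F := FiniteDimensional.of_finrank_pos (by omega)
  exact ⟨fun h ↦ h.isTotallyUmbilic hF hi ht, fun h ↦ h.isPhotonSurface hi ht⟩
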